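/- Let $\beta,\mathfrak c_5\in\mathbb C$ with $(\beta,\mathfrak c_5)\neq(0,0)$ and consider the lattice $x(s)=4\beta s^2+\mathfrak c_5 s$. Let $\mathrm D_x,\mathrm S_x$ be the operators on complex polynomials determined by $$\mathrm D_xf(x(s))=\frac{f(x(s+\frac12))-f(x(s-\frac12))}{x(s+\frac12)-x(s-\frac12)},\qquad \mathrm S_xf(x(s))=\frac{f(x(s+\frac12))+f(x(s-\frac12))}{2}.$$ Let $(P_n)_{n\ge0}$ be a monic orthogonal polynomial sequence with respect to a linear functional $\mathbf u$ on $\mathbb C[z]$, that is, $P_n$ is monic of degree $n$, $\langle\mathbf u,P_nP_m\rangle=0$ for $n\ne m$ and $\langle\mathbf u,P_n^2\rangle\neq0$; let $B_n$, $C_n$ be the coefficients of its recurrence $P_{n+1}(z)=(z-B_n)P_n(z)-C_nP_{n-1}(z)$, $P_{-1}=0$. Assume that for some $a,b,c\in\mathbb C$ and complex sequences $(a_n),(b_n),(c_n)$ with $c_n\ne0$ for all $n\ge0$, $$(az^2+bz+c)\,\mathrm D_xP_n=a_n\mathrm S_xP_{n+1}+b_n\mathrm S_xP_n+c_n\mathrm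 S_xP_{n-1},\qquad n=0,1,2,\dots$$ Put $r_i=c_i+2aC_i$ ($i=2,3$) and $b'=b+2a\beta$, and assume $$6aC_2C_3+4r_3\Big(C_1-\frac{\mathfrak c_5^2}{4}\Big)+r_3\Big((B_1-B_0)^2-8\beta(B_0+B_1-2\beta)-2C_2\Big)=0\quad\text{whenever }a\neq0,$$ $$aC_2C_3\big(b_2+2aB_2+b'\big)-r_3\Big(a(B_2+B_1)C_2+b'C_2-\frac{r_2}{2}(B_1-B_0)\Big)=0 .$$ Let $W_n(y;a_1,a_2,a_3,a_4)$ and $S_n(y;a_1,a_2,a_3)$ denote the Wilson and continuous dual Hahn polynomials as polynomials in $y$ (usually written $y=t^2$), with complex parameters such that no $a_i+a_j$ ($i<j$) and, in the Wilson case, not $a_1+a_2+a_3+a_4$ either, lies in $\{0,-1,-2,\dots\}$. Then: 1. If $\beta\ne0$, there are such parameters for which either, for every $n$, $P_n(z)$ is a nonzero constant multiple of $W_n\big(-\frac1{4\beta}(z+\frac{\mathfrak c_5^2}{16\beta});a_1,a_2,a_3,a_4\big)$, or, for every $n$, $P_n(z)$ is a nonzero constant multiple of $S_n\big(-\frac1{4\beta}(z+\frac{\mathfrak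 c_5^2}{16\beta});a_1,a_2,a_3\big)$. If $\beta=0$, then $(P_n)$ is a limiting case of these polynomials: there is a sequence of families, each consisting of the monic Wilson or of the monic continuous dual Hahn polynomials with such parameters after an affine change of variable, whose $n$-th members converge coefficientwise to $P_n$ for every $n$. 2. One has $r_3\neq0$, and for every $n\ge0$ $$\phi\,\mathrm D_x^2P_n+\psi\,\mathrm S_x\mathrm D_xP_n=\lambda_nP_n,$$ where $$\phi(z)=(z-B_0)(\mathfrak a z-\mathfrak b-\mathfrak aB_1)-(\mathfrak a+1)C_1,\qquad \psi(z)=z-B_0,\qquad \lambda_n=n\big(1+(n-1)\mathfrak a\big),$$ $$\mathfrak a=-\frac{aC_3}{r_3},\qquad \mathfrak b=\tfrac12(B_1-B_0+4\beta).$$ -/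

import Mathlib

open Polynomial Filter Topology

noncomputable section

namespace QuadLattice

/-- The lattice `x(s) = 4 β s² + 𝔠₅ s`. -/
def lattice (β c5 s : ℂ) : ℂ := 4 * β * s ^ 2 + c5 * s

/-- The pair `(D_x zⁿ, S_x zⁿ)`, computed by the product rules for `z · zⁿ`
(`D_x z = 1`, `S_x z = z + β`, `U₂ = 4 β z + 𝔠₅² / 4`). The lemmas `Dx_spec`, `Sx_spec`,
`Dx_unique`, `Sx_unique` below show that `Dx` and `Sx` are the divided-difference and averaging
operators of the lattice. -/
def DSmono (β c5 : ℂ) : ℕ → ℂ[X] × ℂ[X]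
  | 0 => (0, 1)
  | n + 1 =>
    ((X + C β) * (DSmono β c5 n).1 + (DSmono β c5 n).2,
      (C (4 * β) * X + C (c5 ^ 2 / 4)) * (DSmono β c5 n).1 + (X + C β) * (DSmono β c5 n).2)

/-- The divided-difference operator `D_x` on polynomials:
`D_x f (x(s)) = (f(x(s+1/2)) - f(x(s-1/2))) / (x(s+1/2) - x(s-1/2))`. -/
def Dx (β c5 : ℂ) (f : ℂ[X]) : ℂ[X] := f.sum fun n a => C a * (DSmono β c5 n).1

/-- The averaging operator `S_x` on polynomials:
`S_x f (x(s)) = (f(x(s+1/2)) + f(x(s-1/2))) / 2`. -/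
def Sx (β c5 : ℂ) (f : ℂ[X]) : ℂ[X] := f.sum fun n a => C a * (DSmono β c5 n).2

theorem DSmono_spec (β c5 s : ℂ) (n : ℕ) :
    (((DSmono β c5 n).1.eval (lattice β c5 s)) *
        (lattice β c5 (s + 1 / 2) - lattice β c5 (s - 1 / 2)) =
      lattice β c5 (s + 1 / 2) ^ n - lattice β c5 (s - 1 / 2) ^ n) ∧
    (((DSmono β c5 n).2.eval (lattice β c5 s)) * 2 =
      lattice β c5 (s + 1 / 2) ^ n + lattice β c5 (s - 1 / 2) ^ n) := by
  induction n with
  | zero => simp [DSmono]; norm_num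
  | succ n ih =>
    obtain ⟨h1, h2⟩ := ih
    constructor
    · simp only [DSmono, eval_add, eval_mul, eval_X, eval_C, pow_succ]
      simp only [lattice] at *
      linear_combination (4 * β * s ^ 2 + c5 * s + β) * h1 + (4 * β * s + c5 / 2) * h2
    · simp only [DSmono, eval_add, eval_mul, eval_X, eval_C, pow_succ]
      simp only [lattice] at *
      linear_combination (4 * β * s + c5 / 2) * h1 + (4 * β * s ^ 2 + c5 * s + β) * h2

theorem Dx_spec (β c5 s : ℂ) (f : ℂ[X]) :
    (Dx β c5 f).eval (lattice β c5 s) *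
        (lattice β c5 (s + 1 / 2) - lattice β c5 (s - 1 / 2)) =
      f.eval (lattice β c5 (s + 1 / 2)) - f.eval (lattice β c5 (s - 1 / 2)) := by
  rw [Dx, eval_eq_sum (p := f), eval_eq_sum (p := f), Polynomial.sum, Polynomial.sum,
    Polynomial.sum, eval_finsetSum, Finset.sum_mul, ← Finset.sum_sub_distrib]
  refine Finset.sum_congr rfl fun n _ => ?_
  rw [eval_mul, eval_C, mul_assoc, (DSmono_spec β c5 s n).1]
  ring

theorem Sx_spec (β c5 s : ℂ) (f : ℂ[X]) :
    (Sx β c5 f).eval (lattice β c5 s) =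
      (f.eval (lattice β c5 (s + 1 / 2)) + f.eval (lattice β c5 (s - 1 / 2))) / 2 := by
  rw [eq_div_iff two_ne_zero]
  rw [Sx, eval_eq_sum (p := f), eval_eq_sum (p := f), Polynomial.sum, Polynomial.sum,
    Polynomial.sum, eval_finsetSum, Finset.sum_mul, ← Finset.sum_add_distrib]
  refine Finset.sum_congr rfl fun n _ => ?_
  rw [eval_mul, eval_C, mul_assoc, (DSmono_spec β c5 s n).2]
  ring

theorem eq_zero_of_lattice {β c5 : ℂ} (h : (β, c5) ≠ (0, 0)) (g : ℂ[X])
    (hg : ∀ s, g.eval (lattice β c5 s) *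
        (lattice β c5 (s + 1 / 2) - lattice β c5 (s - 1 / 2)) = 0) : g = 0 := by
  have key : g.comp (C (4 * β) * X ^ 2 + C c5 * X) * (C (8 * β) * X + C c5) = 0 := by
    refine Polynomial.funext fun s => ?_
    have := hg s
    simp only [lattice] at this
    simp only [eval_mul, eval_comp, eval_add, eval_C, eval_X, eval_pow, eval_zero]
    linear_combination this
  rcases mul_eq_zero.1 key with h1 | h1
  · rcases comp_eq_zero_iff.1 h1 with h2 | ⟨-, h2⟩
    · exact h2
    · exfalso
      have e1 := congrArg (fun p => p.coeff 1) h2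
      have e2 := congrArg (fun p => p.coeff 2) h2
      simp only [coeff_add, coeff_C_mul, coeff_X, coeff_C, coeff_X_pow] at e1 e2
      norm_num at e1 e2
      exact h (by simp [e1, e2])
  · exfalso
    have e0 := congrArg (fun p => p.coeff 0) h1
    have e1 := congrArg (fun p => p.coeff 1) h1
    simp [coeff_C] at e0 e1
    exact h (by simp [e0, e1])

theorem Dx_unique {β c5 : ℂ} (h : (β, c5) ≠ (0, 0)) (f g : ℂ[X])
    (hg : ∀ s, g.eval (lattice β c5 s) *
        (lattice β c5 (s + 1 / 2) - lattice β c5 (s - 1 / 2)) =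
      f.eval (lattice β c5 (s + 1 / 2)) - f.eval (lattice β c5 (s - 1 / 2))) :
    g = Dx β c5 f := by
  refine sub_eq_zero.1 (eq_zero_of_lattice h _ fun s => ?_)
  rw [eval_sub, sub_mul, hg, Dx_spec, sub_self]

theorem Sx_unique {β c5 : ℂ} (h : (β, c5) ≠ (0, 0)) (f g : ℂ[X])
    (hg : ∀ s, g.eval (lattice β c5 s) =
      (f.eval (lattice β c5 (s + 1 / 2)) + f.eval (lattice β c5 (s - 1 / 2))) / 2) :
    g = Sx β c5 f := by
  refine sub_eq_zero.1 (eq_zero_of_lattice h _ fun s => ?_)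
  rw [eval_sub, hg, Sx_spec, sub_self, zero_mul]

/-- `(Pₙ)` is a monic orthogonal polynomial sequence with respect to the functional `u`. -/
structure IsMonicOPS (u : ℂ[X] →ₗ[ℂ] ℂ) (P : ℕ → ℂ[X]) : Prop where
  monic : ∀ n, (P n).Monic
  natDegree_eq : ∀ n, (P n).natDegree = n
  orthogonal : ∀ n m, n ≠ m → u (P n * P m) = 0
  sq_ne_zero : ∀ n, u (P n * P n) ≠ 0

/-- The recurrence coefficient `Bₙ = ⟨u, z Pₙ²⟩ / ⟨u, Pₙ²⟩`. -/
def recB (u : ℂ[X] →ₗ[ℂ] ℂ) (P : ℕ → ℂ[X]) (n : ℕ) : ℂ :=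
  u (X * (P n * P n)) / u (P n * P n)

/-- The recurrence coefficient `Cₙ = ⟨u, Pₙ²⟩ / ⟨u, Pₙ₋₁²⟩`, for `n ≥ 1`
(the value at `n = 0` has no meaning and is not used). -/
def recC (u : ℂ[X] →ₗ[ℂ] ℂ) (P : ℕ → ℂ[X]) (n : ℕ) : ℂ :=
  u (P n * P n) / u (P (n - 1) * P (n - 1))

/-- `Pₙ₋₁`, with the convention `P₋₁ = 0`. -/
def prev (P : ℕ → ℂ[X]) : ℕ → ℂ[X]
  | 0 => 0
  | n + 1 => P n

/-- A polynomial of degree at most `N` orthogonal to `P₀, …, P_N` vanishes. -/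
theorem IsMonicOPS.eq_zero {u : ℂ[X] →ₗ[ℂ] ℂ} {P : ℕ → ℂ[X]} (h : IsMonicOPS u P) (N : ℕ) :
    ∀ q : ℂ[X], q.degree < N → (∀ k < N, u (q * P k) = 0) → q = 0 := by
  induction N with
  | zero => intro q hq _; simpa using hq
  | succ N ih =>
    intro q hq ho
    have hlow : (q - C (q.coeff N) * P N).degree < N := by
      rw [degree_lt_iff_coeff_zero] at hq ⊢
      intro m hm
      rcases hm.eq_or_lt with rfl | hlt
      · have := h.monic N
        rw [Monic, leadingCoeff, h.natDegree_eq] at this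
        simp [this]
      · rw [coeff_sub, coeff_C_mul, hq m hlt,
          coeff_eq_zero_of_natDegree_lt (p := P N) (by rw [h.natDegree_eq]; exact hlt)]
        simp
    have hz := ih _ hlow fun k hk => by
      rw [sub_mul, map_sub, ho k (hk.trans (Nat.lt_succ_self N)), mul_assoc, ← smul_eq_C_mul,
        map_smul, h.orthogonal N k hk.ne']
      simp
    have hq' : q = C (q.coeff N) * P N := sub_eq_zero.1 hz
    have h0 := ho N (Nat.lt_succ_self N)
    rw [hq', mul_assoc, ← smul_eq_C_mul, map_smul, smul_eq_mul] at h0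
    have := (mul_eq_zero.1 h0).resolve_right (h.sq_ne_zero N)
    rw [hq', this]; simp

/-- A polynomial of degree less than `n` is orthogonal to `Pₙ`. -/
theorem IsMonicOPS.orth_of_degree_lt {u : ℂ[X] →ₗ[ℂ] ℂ} {P : ℕ → ℂ[X]} (h : IsMonicOPS u P)
    (n N : ℕ) (hN : N ≤ n) : ∀ q : ℂ[X], q.degree < N → u (q * P n) = 0 := by
  induction N with
  | zero => intro q hq; have : q = 0 := by simpa using hq
            simp [this]
  | succ N ih =>
    intro q hq
    have hlow : (q - C (q.coeff N) * P N).degree < N := by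
      rw [degree_lt_iff_coeff_zero] at hq ⊢
      intro m hm
      rcases hm.eq_or_lt with rfl | hlt
      · have := h.monic N
        rw [Monic, leadingCoeff, h.natDegree_eq] at this
        simp [this]
      · rw [coeff_sub, coeff_C_mul, hq m hlt,
          coeff_eq_zero_of_natDegree_lt (p := P N) (by rw [h.natDegree_eq]; exact hlt)]
        simp
    have h0 := ih (by omega) _ hlow
    rw [sub_mul, map_sub, mul_assoc, ← smul_eq_C_mul, map_smul,
      h.orthogonal N n (by omega)] at h0
    simpa using h0

/-- The three-term recurrence relation `Pₙ₊₁ = (z - Bₙ) Pₙ - Cₙ Pₙ₋₁`. -/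
theorem IsMonicOPS.recurrence {u : ℂ[X] →ₗ[ℂ] ℂ} {P : ℕ → ℂ[X]} (h : IsMonicOPS u P) (n : ℕ) :
    P (n + 1) = (X - C (recB u P n)) * P n - C (recC u P n) * prev P n := by
  have hlt : ∀ m : ℕ, (P m).degree = (m : WithBot ℕ) := fun m => by
    rw [degree_eq_natDegree (h.monic m).ne_zero, h.natDegree_eq]
  have hXP : (X * P n - P (n + 1)).degree < ((n + 1 : ℕ) : WithBot ℕ) := by
    have := degree_sub_lt_left (p := X * P n) (q := P (n + 1))
      (by rw [degree_mul, degree_X, hlt, hlt]; push_cast; ring)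
      (mul_ne_zero X_ne_zero (h.monic n).ne_zero)
      (by rw [leadingCoeff_mul, leadingCoeff_X, (h.monic n).leadingCoeff,
        (h.monic (n + 1)).leadingCoeff, one_mul])
    rw [degree_mul, degree_X, hlt] at this
    refine this.trans_eq ?_
    push_cast; ring
  have hle : ∀ m, m < n + 1 → (P m).degree < ((n + 1 : ℕ) : WithBot ℕ) := fun m hm => by
    rw [hlt]; exact_mod_cast hm
  have hCle : ∀ (c : ℂ) (q : ℂ[X]), q.degree < ((n + 1 : ℕ) : WithBot ℕ) → (C c * q).degree < ((n + 1 : ℕ) : WithBot ℕ) := by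
    intro c q hq
    rw [degree_lt_iff_coeff_zero] at hq ⊢
    intro m hm; rw [coeff_C_mul, hq m hm, mul_zero]
  have hprev : (prev P n).degree < ((n + 1 : ℕ) : WithBot ℕ) := by
    cases n with
    | zero => simp [prev]
    | succ n => exact hle n (by omega)
  have hz : X * P n - P (n + 1) - C (recB u P n) * P n - C (recC u P n) * prev P n = 0 := by
    refine h.eq_zero (n + 1) _ ?_ ?_
    · exact lt_of_le_of_lt (degree_sub_le _ _) (max_lt
        (lt_of_le_of_lt (degree_sub_le _ _) (max_lt hXP (hCle _ _ (hle n (by omega)))))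
        (hCle _ _ hprev))
    · intro k hk
      have hrec : ∀ c q, u (C c * q * P k) = c * u (q * P k) := fun c q => by
        rw [mul_assoc, ← smul_eq_C_mul, map_smul, smul_eq_mul]
      rw [sub_mul, sub_mul, sub_mul, map_sub, map_sub, map_sub, hrec, hrec,
        h.orthogonal (n + 1) k (by omega)]
      rcases lt_trichotomy (k + 1) n with h1 | h1 | h1
      · have e1 : u (X * P n * P k) = 0 := by
          rw [show X * P n * P k = (X * P k) * P n by ring]
          refine h.orth_of_degree_lt n n le_rfl _ ?_
          rw [degree_mul, degree_X, hlt]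
          have : ((1 + k : ℕ) : WithBot ℕ) < n := by exact_mod_cast (by omega : 1 + k < n)
          simpa using this
        have e3 : u (prev P n * P k) = 0 := by
          cases n with
          | zero => simp [prev]
          | succ n => exact h.orthogonal n k (by omega)
        rw [e1, h.orthogonal n k (by omega), e3]; ring
      · subst h1
        have e1 : u (X * P (k + 1) * P k) = u (P (k + 1) * P (k + 1)) := by
          rw [show X * P (k + 1) * P k = (X * P k - P (k + 1)) * P (k + 1)
            + P (k + 1) * P (k + 1) by ring, map_add]
          rw [h.orth_of_degree_lt (k + 1) (k + 1) le_rfl, zero_add]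
          have := degree_sub_lt_left (p := X * P k) (q := P (k + 1))
            (by rw [degree_mul, degree_X, hlt, hlt]; push_cast; ring)
            (mul_ne_zero X_ne_zero (h.monic k).ne_zero)
            (by rw [leadingCoeff_mul, leadingCoeff_X, (h.monic k).leadingCoeff,
              (h.monic (k + 1)).leadingCoeff, one_mul])
          rw [degree_mul, degree_X, hlt] at this
          refine this.trans_eq ?_
          push_cast; ring
        rw [e1, h.orthogonal (k + 1) k (by omega)]
        simp only [prev, recC, Nat.add_sub_cancel]
        have := h.sq_ne_zero k
        field_simp
        ring
      · have hkn : k = n := by omega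
        subst hkn
        have e3 : u (prev P k * P k) = 0 := by
          cases k with
          | zero => simp [prev]
          | succ k => exact h.orthogonal k (k + 1) (by omega)
        rw [e3, recB, mul_assoc]
        have := h.sq_ne_zero k
        field_simp
        ring
  linear_combination -hz

/-- The Pochhammer symbol `(x)ₙ = x (x + 1) ⋯ (x + n - 1)`. -/
def poch (x : ℂ) (n : ℕ) : ℂ := ∏ j ∈ Finset.range n, (x + j)

/-- The Wilson polynomial `Wₙ(y; a, b, c, d)`, as a polynomial in `y = x²`:
`(a+b)ₙ (a+c)ₙ (a+d)ₙ ₄F₃(-n, n+a+b+c+d-1, a+ix, a-ix; a+b, a+c, a+d; 1)`,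
where `(a+ix)ₖ (a-ix)ₖ = ∏_{j<k} (y + (a+j)²)` and the denominators have been cleared
by means of `(e)ₙ / (e)ₖ = (e+k)ₙ₋ₖ`. -/
def wilson (a b c d : ℂ) (n : ℕ) : ℂ[X] :=
  ∑ k ∈ Finset.range (n + 1),
    C (poch (-(n : ℂ)) k * poch (n + a + b + c + d - 1) k / (k.factorial : ℂ) *
        (poch (a + b + k) (n - k) * poch (a + c + k) (n - k) * poch (a + d + k) (n - k))) *
      ∏ j ∈ Finset.range k, (X + C ((a + j) ^ 2))

/-- The continuous dual Hahn polynomial `Sₙ(y; a, b, c)`, as a polynomial in `y = x²`: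
`(a+b)ₙ (a+c)ₙ ₃F₂(-n, a+ix, a-ix; a+b, a+c; 1)`, with denominators cleared. -/
def contDualHahn (a b c : ℂ) (n : ℕ) : ℂ[X] :=
  ∑ k ∈ Finset.range (n + 1),
    C (poch (-(n : ℂ)) k / (k.factorial : ℂ) *
        (poch (a + b + k) (n - k) * poch (a + c + k) (n - k))) *
      ∏ j ∈ Finset.range k, (X + C ((a + j) ^ 2))

/-- The usual restrictions on the (complex) parameters of the Wilson polynomials: no pair sum,
nor the sum of all four parameters, is zero or a negative integer. -/
def WilsonParams (a b c d : ℂ) : Prop :=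
  ∀ k : ℕ, a + b ≠ -(k : ℂ) ∧ a + c ≠ -(k : ℂ) ∧ a + d ≠ -(k : ℂ) ∧ b + c ≠ -(k : ℂ) ∧
    b + d ≠ -(k : ℂ) ∧ c + d ≠ -(k : ℂ) ∧ a + b + c + d ≠ -(k : ℂ)

/-- The usual restrictions on the (complex) parameters of the continuous dual Hahn polynomials. -/
def ContDualHahnParams (a b c : ℂ) : Prop :=
  ∀ k : ℕ, a + b ≠ -(k : ℂ) ∧ a + c ≠ -(k : ℂ) ∧ b + c ≠ -(k : ℂ)

/-- For some admissible parameters, `Pₙ(z)` is for every `n` a nonzero constant multiple of the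
Wilson polynomial `Wₙ(κ z + μ; a, b, c, d)`. -/
def IsWilson (κ μ : ℂ) (P : ℕ → ℂ[X]) : Prop :=
  ∃ a b c d : ℂ, WilsonParams a b c d ∧
    ∀ n, ∃ r : ℂ, r ≠ 0 ∧ P n = C r * (wilson a b c d n).comp (C κ * X + C μ)

/-- For some admissible parameters, `Pₙ(z)` is for every `n` a nonzero constant multiple of the
continuous dual Hahn polynomial `Sₙ(κ z + μ; a, b, c)`. -/
def IsContDualHahn (κ μ : ℂ) (P : ℕ → ℂ[X]) : Prop :=
  ∃ a b c : ℂ, ContDualHahnParams a b c ∧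
    ∀ n, ∃ r : ℂ, r ≠ 0 ∧ P n = C r * (contDualHahn a b c n).comp (C κ * X + C μ)

/-- `(Pₙ)` is a limiting case of the Wilson or continuous dual Hahn polynomials: it is the
coefficientwise limit of a sequence of families `(R m n)ₙ`, each of which consists of the monic
Wilson or continuous dual Hahn polynomials after an affine change of the variable. -/
def IsLimitingCase (P : ℕ → ℂ[X]) : Prop :=
  ∃ R : ℕ → ℕ → ℂ[X],
    (∀ m, (∀ n, (R m n).Monic) ∧
      ∃ κ μ : ℂ, κ ≠ 0 ∧ (IsWilson κ μ (R m) ∨ IsContDualHahn κ μ (R m))) ∧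
    ∀ n k, Tendsto (fun m => (R m n).coeff k) atTop (𝓝 ((P n).coeff k))

end QuadLattice

end

open QuadLattice

/-! Everything is reduced to the Pearson-type equation `u (φ * D f + ψ * S f) = 0`, where D and S
denote the divided-difference and averaging operators. Since D is onto with the constants as kernel
and `u (P 1) = 0`, there is a functional N with `N (D f) = u (P 1 * f)`. Moving the quadratic factor
of the structure relation inside D and applying N gives a recurrence for the numbers `N (S (P n))`.
The two side conditions are what it takes to have `N (S (P 2))` equal to `-𝔞 C₂ u(P₁²)` and all
later values zero. Then N ∘ S and `-(φ + 2βψ) u` agree on every `P n`, which is the Pearson equation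
(`functional_equation`).

Let L = φD² + ψSD, and let M be its commutator with multiplication by z. The Pearson equation yields
`u (L f) = 0` and `u (M f) = -u (ψ f)`. By induction, the adjoint of L with respect to `u` sends z^k
to a polynomial of degree at most k (`exists_adjoint`). As L preserves degree filtrations as well,
each `P n` is an eigenvector (`opL_eigen`). Regularity of `u` forces `1 + k𝔞 ≠ 0` for all k
(`eigen_admissible`), so the eigenvalues are distinct and a monic eigenvector of given degree is
unique.

For β ≠ 0 the variable y = κz + μ equals -t² with t a translate of s. On the basis ∏(y + (a+j)²) the
operator L is bidiagonal as soon as a is a root of a quartic built from φ and ψ (a cubic when 𝔞 =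
0). Solving the two-term recurrence gives Wilson or continuous dual Hahn polynomials, and uniqueness
identifies them with `P n`. Forbidden pair sums would make consecutive `P n` share a zero
(`IsMonicOPS.ne_neg_nat`).

For β = 0, keep φ, ψ and 𝔠₅ and let β = 1/(m+1) tend to 0. Monic eigenvectors depend continuously on
β, and a small generic shift of the parameters makes them admissible. -/

namespace QuadLattice

/-! ### Linear operators D and S and their calculus, checked at lattice points -/

/-- `D_x` as a linear map. -/
noncomputable def dX (β c5 : ℂ) : ℂ[X] →ₗ[ℂ] ℂ[X] where
  toFun := Dx β c5
  map_add' f g := by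
    rw [Dx, Dx, Dx, sum_add_index] <;> simp [add_mul]
  map_smul' r f := by
    rw [Dx, Dx, sum_smul_index _ _ _ (by simp), Polynomial.sum, Polynomial.sum]
    simp [Finset.smul_sum, smul_eq_C_mul, mul_assoc]

/-- `S_x` as a linear map. -/
noncomputable def sX (β c5 : ℂ) : ℂ[X] →ₗ[ℂ] ℂ[X] where
  toFun := Sx β c5
  map_add' f g := by
    rw [Sx, Sx, Sx, sum_add_index] <;> simp [add_mul]
  map_smul' r f := by
    rw [Sx, Sx, sum_smul_index _ _ _ (by simp), Polynomial.sum, Polynomial.sum]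
    simp [Finset.smul_sum, smul_eq_C_mul, mul_assoc]

theorem dX_apply (β c5 : ℂ) (f : ℂ[X]) : dX β c5 f = Dx β c5 f := rfl
theorem sX_apply (β c5 : ℂ) (f : ℂ[X]) : sX β c5 f = Sx β c5 f := rfl

section Basic
variable (β c5 : ℂ)

theorem dX_X_pow (n : ℕ) : dX β c5 (X ^ n) = (DSmono β c5 n).1 := by
  rw [dX_apply, Dx, ← monomial_one_right_eq_X_pow, sum_monomial_index _ _ (by simp)]; simp
theorem sX_X_pow (n : ℕ) : sX β c5 (X ^ n) = (DSmono β c5 n).2 := by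
  rw [sX_apply, Sx, ← monomial_one_right_eq_X_pow, sum_monomial_index _ _ (by simp)]; simp

@[simp] theorem dX_C (r : ℂ) : dX β c5 (C r) = 0 := by
  rw [← mul_one (C r), ← smul_eq_C_mul, map_smul, ← pow_zero X, dX_X_pow]; simp [DSmono]
@[simp] theorem sX_C (r : ℂ) : sX β c5 (C r) = C r := by
  rw [← mul_one (C r), ← smul_eq_C_mul, map_smul, ← pow_zero X, sX_X_pow]; simp [DSmono]
@[simp] theorem dX_one : dX β c5 1 = 0 := dX_C β c5 1
@[simp] theorem sX_one : sX β c5 1 = 1 := sX_C β c5 1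
@[simp] theorem dX_X : dX β c5 X = 1 := by
  rw [← pow_one X, dX_X_pow]; simp [DSmono]
@[simp] theorem sX_X : sX β c5 X = X + C β := by
  rw [← pow_one X, sX_X_pow]; simp [DSmono]

theorem dX_C_mul (r : ℂ) (f : ℂ[X]) : dX β c5 (C r * f) = C r * dX β c5 f := by
  rw [← smul_eq_C_mul, map_smul, smul_eq_C_mul]
theorem sX_C_mul (r : ℂ) (f : ℂ[X]) : sX β c5 (C r * f) = C r * sX β c5 f := by
  rw [← smul_eq_C_mul, map_smul, smul_eq_C_mul]

end Basic

section Rules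
variable {β c5 : ℂ} (hl : (β, c5) ≠ (0, 0))
include hl

theorem dX_mul (f g : ℂ[X]) :
    dX β c5 (f * g) = dX β c5 f * sX β c5 g + sX β c5 f * dX β c5 g := by
  refine (Dx_unique hl (f * g) _ fun s => ?_).symm
  have h1 := Dx_spec β c5 s f
  have h2 := Dx_spec β c5 s g
  simp only [dX_apply, sX_apply, eval_add, eval_mul, Sx_spec]
  linear_combination (eval (lattice β c5 (s + 1 / 2)) g + eval (lattice β c5 (s - 1 / 2)) g) / 2 * h1
    + (eval (lattice β c5 (s + 1 / 2)) f + eval (lattice β c5 (s - 1 / 2)) f) / 2 * h2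

theorem sX_mul (f g : ℂ[X]) :
    sX β c5 (f * g) = sX β c5 f * sX β c5 g +
      (C (4 * β) * X + C (c5 ^ 2 / 4)) * (dX β c5 f * dX β c5 g) := by
  refine (Sx_unique hl (f * g) _ fun s => ?_).symm
  have h1 := Dx_spec β c5 s f
  have h2 := Dx_spec β c5 s g
  have h3 : 4 * β * lattice β c5 s + c5 ^ 2 / 4 =
      ((lattice β c5 (s + 1 / 2) - lattice β c5 (s - 1 / 2)) / 2) ^ 2 := by
    simp only [lattice]; ring
  simp only [dX_apply, sX_apply, eval_add, eval_mul, Sx_spec, eval_C, eval_X, h3]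
  linear_combination (1 / 4) * (Dx β c5 g).eval (lattice β c5 s) *
    (lattice β c5 (s + 1 / 2) - lattice β c5 (s - 1 / 2)) * h1 + (1 / 4) *
    (eval (lattice β c5 (s + 1 / 2)) f - eval (lattice β c5 (s - 1 / 2)) f) * h2

/-- Both sides involve only the values of f at x(s+1), x(s) and x(s-1). The term with 2β measures
the failure of the step of the lattice to be constant. -/
theorem dX_sX (f : ℂ[X]) :
    dX β c5 (sX β c5 f) = sX β c5 (dX β c5 f) + C (2 * β) * dX β c5 (dX β c5 f) := by
  refine (Dx_unique hl (sX β c5 f) _ fun s => ?_).symm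
  have h1 := Dx_spec β c5 (s + 1 / 2) f
  have h2 := Dx_spec β c5 (s - 1 / 2) f
  have h3 := Dx_spec β c5 s (Dx β c5 f)
  simp only [dX_apply, sX_apply, eval_add, eval_mul, Sx_spec, eval_C]
  have e1 : s + 1 / 2 + 1 / 2 = s + 1 := by ring
  have e2 : s + 1 / 2 - 1 / 2 = s := by ring
  have e3 : s - 1 / 2 + 1 / 2 = s := by ring
  have e4 : s - 1 / 2 - 1 / 2 = s - 1 := by ring
  rw [e1, e2] at h1 ⊢
  rw [e3, e4] at h2 ⊢
  rw [add_mul, mul_assoc, h3]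
  simp only [lattice] at *
  linear_combination (1 / 2) * h1 + (1 / 2) * h2

theorem sX_sX (f : ℂ[X]) :
    sX β c5 (sX β c5 f) = f + C (2 * β) * sX β c5 (dX β c5 f) +
      (C (4 * β) * X + C (c5 ^ 2 / 4)) * dX β c5 (dX β c5 f) := by
  refine (Sx_unique hl (sX β c5 f) _ fun s => ?_).symm
  have h1 := Dx_spec β c5 (s + 1 / 2) f
  have h2 := Dx_spec β c5 (s - 1 / 2) f
  have h3 := Dx_spec β c5 s (Dx β c5 f)
  simp only [dX_apply, sX_apply, eval_add, eval_mul, Sx_spec, eval_C, eval_X]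
  have e1 : s + 1 / 2 + 1 / 2 = s + 1 := by ring
  have e2 : s + 1 / 2 - 1 / 2 = s := by ring
  have e3 : s - 1 / 2 + 1 / 2 = s := by ring
  have e4 : s - 1 / 2 - 1 / 2 = s - 1 := by ring
  rw [e1, e2] at h1 ⊢
  rw [e3, e4] at h2 ⊢
  simp only [lattice] at *
  linear_combination (1 / 4) * h1 - (1 / 4) * h2 + (8 * β * s + c5) / 4 * h3

theorem dX_X_mul (f : ℂ[X]) :
    dX β c5 (X * f) = (X + C β) * dX β c5 f + sX β c5 f := by
  rw [dX_mul hl, dX_X, sX_X]; ring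

theorem sX_X_mul (f : ℂ[X]) :
    sX β c5 (X * f) = (C (4 * β) * X + C (c5 ^ 2 / 4)) * dX β c5 f + (X + C β) * sX β c5 f := by
  rw [sX_mul hl, dX_X, sX_X]; ring

end Rules

/-! ### Degrees and leading coefficients under D and S -/

section Degree
variable (β c5 : ℂ)

theorem DSmono_degree (n : ℕ) :
    ((DSmono β c5 n).1.degree < (n : WithBot ℕ)) ∧
    -- At n = 0 the truncated index is 0 and both sides vanish.
    ((DSmono β c5 n).1.coeff (n - 1) = n) ∧
    ((DSmono β c5 n).2.degree < ((n + 1 : ℕ) : WithBot ℕ)) ∧ ((DSmono β c5 n).2.coeff n = 1) := by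
  induction n with
  | zero => simp [DSmono, degree_one]
  | succ n ih =>
    obtain ⟨h1, h2, h3, h4⟩ := ih
    rw [degree_lt_iff_coeff_zero] at h1 h3
    have hp : (DSmono β c5 n).1.coeff (n - 1) = n ∧ ((DSmono β c5 n).1.coeff n = 0) :=
      ⟨h2, h1 n le_rfl⟩
    refine ⟨?_, ?_, ?_, ?_⟩
    · rw [degree_lt_iff_coeff_zero]
      intro m hm
      obtain ⟨m, rfl⟩ : ∃ k, m = k + 1 := ⟨m - 1, by omega⟩
      simp only [DSmono, coeff_add, add_mul, coeff_X_mul, coeff_C_mul]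
      rw [h1 m (by omega), h1 (m + 1) (by omega), h3 (m + 1) (by omega)]; simp
    · simp only [DSmono, coeff_add, add_mul, coeff_C_mul, Nat.add_sub_cancel, h4, hp.2]
      cases n with
      | zero => simp
      | succ k => rw [coeff_X_mul]; simp at h2; rw [h2]; push_cast; ring
    · rw [degree_lt_iff_coeff_zero]
      intro m hm
      obtain ⟨m, rfl⟩ : ∃ k, m = k + 1 := ⟨m - 1, by omega⟩
      simp only [DSmono, coeff_add, add_mul, mul_assoc, coeff_X_mul, coeff_C_mul]
      rw [h1 m (by omega), h1 (m + 1) (by omega), h3 (m + 1) (by omega), h3 m (by omega)]; simp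
    · simp only [DSmono, coeff_add, add_mul, mul_assoc, coeff_X_mul, coeff_C_mul]
      rw [h1 n (by omega), h1 (n + 1) (by omega), h3 (n + 1) (by omega), h4]; simp

theorem coeff_dX (f : ℂ[X]) (m : ℕ) :
    (dX β c5 f).coeff m = f.sum fun n a => a * (DSmono β c5 n).1.coeff m := by
  simp [dX_apply, Dx, Polynomial.sum]

theorem coeff_sX (f : ℂ[X]) (m : ℕ) :
    (sX β c5 f).coeff m = f.sum fun n a => a * (DSmono β c5 n).2.coeff m := by
  simp [sX_apply, Sx, Polynomial.sum]

theorem dX_degree {f : ℂ[X]} {n : ℕ} (hf : f.degree < ((n + 1 : ℕ) : WithBot ℕ)) :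
    (dX β c5 f).degree < (n : WithBot ℕ) := by
  rw [degree_lt_iff_coeff_zero] at hf ⊢
  intro m hm
  rw [coeff_dX, Polynomial.sum]
  refine Finset.sum_eq_zero fun k _ => ?_
  rcases lt_or_ge k (n + 1) with h | h
  · rw [((degree_lt_iff_coeff_zero _ _).1 (DSmono_degree β c5 k).1) m (by omega), mul_zero]
  · rw [hf k h, zero_mul]

theorem sX_degree {f : ℂ[X]} {n : ℕ} (hf : f.degree < (n : WithBot ℕ)) :
    (sX β c5 f).degree < (n : WithBot ℕ) := by
  rw [degree_lt_iff_coeff_zero] at hf ⊢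
  intro m hm
  rw [coeff_sX, Polynomial.sum]
  refine Finset.sum_eq_zero fun k _ => ?_
  rcases lt_or_ge k n with h | h
  · rw [((degree_lt_iff_coeff_zero _ _).1 (DSmono_degree β c5 k).2.2.1) m (by omega), mul_zero]
  · rw [hf k h, zero_mul]

theorem degree_sub_monomial_lt {f : ℂ[X]} {n : ℕ} (hf : f.degree < ((n + 1 : ℕ) : WithBot ℕ)) :
    (f - C (f.coeff n) * X ^ n).degree < (n : WithBot ℕ) := by
  rw [degree_lt_iff_coeff_zero] at hf ⊢
  intro m hm
  rw [coeff_sub, coeff_C_mul, coeff_X_pow]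
  rcases hm.eq_or_lt with rfl | h
  · simp
  · rw [hf m h, if_neg (by omega)]; simp

theorem dX_coeff_top {f : ℂ[X]} {n : ℕ} (hf : f.degree < ((n + 2 : ℕ) : WithBot ℕ)) :
    (dX β c5 f).coeff n = (n + 1) * f.coeff (n + 1) := by
  have h1 := degree_sub_monomial_lt hf
  have h2 := dX_degree β c5 h1
  rw [map_sub, dX_C_mul, dX_X_pow] at h2
  have h3 := (degree_lt_iff_coeff_zero _ _).1 h2 n le_rfl
  have h4 := (DSmono_degree β c5 (n + 1)).2.1
  rw [Nat.add_sub_cancel] at h4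
  rw [coeff_sub, coeff_C_mul, h4] at h3
  push_cast at h3
  linear_combination h3

theorem sX_coeff_top {f : ℂ[X]} {n : ℕ} (hf : f.degree < ((n + 1 : ℕ) : WithBot ℕ)) :
    (sX β c5 f).coeff n = f.coeff n := by
  have h2 := sX_degree β c5 (degree_sub_monomial_lt hf)
  rw [map_sub, sX_C_mul, sX_X_pow] at h2
  have h3 := (degree_lt_iff_coeff_zero _ _).1 h2 n le_rfl
  rw [coeff_sub, coeff_C_mul, (DSmono_degree β c5 n).2.2.2] at h3
  linear_combination h3

/-- D lowers the degree by exactly one, multiplying the leading coefficient by `n + 1 ≠ 0`, so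
preimages are built from the top coefficient down. -/
theorem dX_surjective : Function.Surjective (dX β c5) := by
  suffices h : ∀ n : ℕ, ∀ g : ℂ[X], g.degree < (n : WithBot ℕ) → ∃ f, dX β c5 f = g from
    fun g => h (g.natDegree + 1) g (lt_of_le_of_lt degree_le_natDegree
      (by exact_mod_cast Nat.lt_succ_self _))
  intro n
  induction n with
  | zero => intro g hg; exact ⟨0, by simp at hg; simp [hg]⟩
  | succ n ih =>
    intro g hg
    have hn : ((n : ℂ) + 1) ≠ 0 := by exact_mod_cast n.succ_ne_zero
    have hd : (X ^ (n + 1) : ℂ[X]).degree < ((n + 2 : ℕ) : WithBot ℕ) := by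
      rw [degree_X_pow]; exact_mod_cast Nat.lt_succ_self _
    obtain ⟨f, hf⟩ := ih (g - C (g.coeff n / (n + 1)) * dX β c5 (X ^ (n + 1))) (by
      have h1 := dX_degree β c5 hd
      rw [degree_lt_iff_coeff_zero] at hg h1 ⊢
      intro m hm
      rw [coeff_sub, coeff_C_mul]
      rcases hm.eq_or_lt with rfl | h
      · rw [dX_coeff_top β c5 hd, coeff_X_pow]; simp; field_simp; simp
      · rw [hg m h, h1 m h]; simp)
    exact ⟨f + C (g.coeff n / (n + 1)) * X ^ (n + 1), by rw [map_add, hf, dX_C_mul]; ring⟩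

theorem eq_C_of_dX_eq_zero {f : ℂ[X]} (hf : dX β c5 f = 0) : f = C (f.coeff 0) := by
  refine eq_C_of_natDegree_eq_zero ?_
  by_contra h
  obtain ⟨n, hn⟩ := Nat.exists_eq_succ_of_ne_zero h
  have hd : f.degree < ((n + 2 : ℕ) : WithBot ℕ) :=
    lt_of_le_of_lt degree_le_natDegree (by rw [hn]; exact_mod_cast Nat.lt_succ_self _)
  have h1 := dX_coeff_top β c5 hd
  rw [hf, coeff_zero] at h1
  have h2 : f.coeff (n + 1) = f.leadingCoeff := by rw [leadingCoeff, hn]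
  have h3 : ((n : ℂ) + 1) ≠ 0 := by exact_mod_cast n.succ_ne_zero
  rw [h2] at h1
  rcases mul_eq_zero.1 h1.symm with h4 | h4
  · exact h3 h4
  · rw [leadingCoeff_eq_zero] at h4; simp [h4] at hn

end Degree

/-! ### Orthogonality: leading coefficients, norms, and functionals tested on the sequence -/

section OPS
variable {u : ℂ[X] →ₗ[ℂ] ℂ} {P : ℕ → ℂ[X]} (hP : IsMonicOPS u P)
include hP

theorem IsMonicOPS.degree_lt (n : ℕ) : (P n).degree < ((n + 1 : ℕ) : WithBot ℕ) := by
  rw [degree_eq_natDegree (hP.monic n).ne_zero, hP.natDegree_eq]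
  exact_mod_cast Nat.lt_succ_self _

theorem IsMonicOPS.coeff_self (n : ℕ) : (P n).coeff n = 1 := by
  have := hP.monic n
  rwa [Monic, leadingCoeff, hP.natDegree_eq] at this

theorem IsMonicOPS.zero_eq : P 0 = 1 :=
  eq_one_of_monic_natDegree_zero (hP.monic 0) (hP.natDegree_eq 0)

theorem IsMonicOPS.recC_ne_zero (n : ℕ) : recC u P n ≠ 0 :=
  div_ne_zero (hP.sq_ne_zero n) (hP.sq_ne_zero _)

theorem IsMonicOPS.sq_succ (n : ℕ) :
    u (P (n + 1) * P (n + 1)) = recC u P (n + 1) * u (P n * P n) := by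
  have := hP.sq_ne_zero n
  rw [recC, Nat.add_sub_cancel]; field_simp

theorem IsMonicOPS.ext_functional {H : ℂ[X] →ₗ[ℂ] ℂ} (hH : ∀ n, H (P n) = 0) (f : ℂ[X]) :
    H f = 0 := by
  suffices h : ∀ n : ℕ, ∀ g : ℂ[X], g.degree < (n : WithBot ℕ) → H g = 0 from
    h (f.natDegree + 1) f (lt_of_le_of_lt degree_le_natDegree
      (by exact_mod_cast Nat.lt_succ_self _))
  intro n
  induction n with
  | zero => intro g hg; simp at hg; simp [hg]
  | succ n ih =>
    intro g hg
    have h1 := ih (g - C (g.coeff n) * P n) (by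
      have h1 := hP.degree_lt n
      rw [degree_lt_iff_coeff_zero] at hg h1 ⊢
      intro m hm
      rw [coeff_sub, coeff_C_mul]
      rcases hm.eq_or_lt with rfl | h
      · rw [hP.coeff_self]; ring
      · rw [hg m h, h1 m h]; simp)
    rw [map_sub, ← smul_eq_C_mul, map_smul, hH n] at h1
    simpa using h1

/-- If `u (q P_n) = 0` for all `n` then `q = 0`. -/
theorem IsMonicOPS.eq_zero_of_forall {q : ℂ[X]} (hq : ∀ f, u (q * f) = 0) : q = 0 :=
  hP.eq_zero (q.natDegree + 1) q (lt_of_le_of_lt degree_le_natDegree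
      (by exact_mod_cast Nat.lt_succ_self _)) fun _ _ => hq _

end OPS

/-! ### The structure relation in shifted form -/

/-- Commuting a quadratic factor past `D_x`. -/
theorem quadratic_mul_dX {β c5 : ℂ} (hl : (β, c5) ≠ (0, 0)) (a b c : ℂ) (f : ℂ[X]) :
    (C a * X ^ 2 + C b * X + C c) * dX β c5 f =
      dX β c5 ((C a * X ^ 2 + C (b + 2 * a * β) * X +
        C (a * (c5 ^ 2 / 4 - 3 * β ^ 2) - b * β + c)) * f) -
      sX β c5 ((C (2 * a) * X + C (b + 2 * a * β)) * f) := by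
  have e1 : ∀ p q r : ℂ, (C p * X ^ 2 + C q * X + C r) * f =
    C p * (X * (X * f)) + C q * (X * f) + C r * f := fun p q r => by ring
  have e2 : ∀ p q : ℂ, (C p * X + C q) * f = C p * (X * f) + C q * f := fun p q => by ring
  rw [e1, e2]
  simp only [map_add (dX β c5), map_add (sX β c5), dX_C_mul, sX_C_mul, dX_X_mul hl, sX_X_mul hl]
  generalize c5 ^ 2 / 4 = γ
  simp only [C_add, C_mul, C_sub, C_pow, C_ofNat]
  ring

/-- D is onto and its kernel consists of constants, which `v` kills; hence `v` factors through D. -/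
theorem exists_antiderivative (β c5 : ℂ) (v : ℂ[X] →ₗ[ℂ] ℂ) (hv : v 1 = 0) :
    ∃ N : ℂ[X] →ₗ[ℂ] ℂ, ∀ f, N (dX β c5 f) = v f := by
  obtain ⟨g, hg⟩ := (dX β c5).exists_rightInverse_of_surjective
    (LinearMap.range_eq_top.2 (dX_surjective β c5))
  refine ⟨v.comp g, fun f => ?_⟩
  have h1 : dX β c5 (g (dX β c5 f) - f) = 0 := by
    have := LinearMap.congr_fun hg (dX β c5 f)
    simp only [LinearMap.comp_apply, LinearMap.id_apply] at this
    rw [map_sub, this, sub_self]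
  have h2 := eq_C_of_dX_eq_zero β c5 h1
  have h3 : v (g (dX β c5 f) - f) = 0 := by
    rw [h2, ← mul_one (C _), ← smul_eq_C_mul, map_smul, hv, smul_zero]
  rw [map_sub] at h3
  simpa using sub_eq_zero.1 h3

section Structure
variable {β c5 : ℂ} (hl : (β, c5) ≠ (0, 0))
  {u : ℂ[X] →ₗ[ℂ] ℂ} {P : ℕ → ℂ[X]} (hP : IsMonicOPS u P)
  {a b c : ℂ} {an bn cn : ℕ → ℂ}
  (hrel : ∀ n, (C a * X ^ 2 + C b * X + C c) * Dx β c5 (P n) =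
      C (an n) * Sx β c5 (P (n + 1)) + C (bn n) * Sx β c5 (P n) + C (cn n) * Sx β c5 (prev P n))
include hP hrel

theorem structure_an (n : ℕ) : an (n + 1) = (n + 1) * a := by
  have h := congrArg (fun p => p.coeff (n + 2)) (hrel (n + 1))
  simp only [← dX_apply, ← sX_apply, coeff_add, coeff_C_mul, add_mul, prev, pow_two, mul_assoc] at h
  have d1 := (degree_lt_iff_coeff_zero _ _).1 (dX_degree β c5 (hP.degree_lt (n + 1)))
  have s1 := sX_coeff_top β c5 (hP.degree_lt (n + 1 + 1))
  have s2 := (degree_lt_iff_coeff_zero _ _).1 (sX_degree β c5 (hP.degree_lt (n + 1))) (n + 2) le_rfl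
  have s3 := (degree_lt_iff_coeff_zero _ _).1 (sX_degree β c5 (hP.degree_lt n)) (n + 2) (by omega)
  have d2 := dX_coeff_top β c5 (hP.degree_lt (n + 1))
  rw [hP.coeff_self] at s1 d2
  rw [coeff_X_mul, coeff_X_mul, coeff_X_mul, d1 (n + 1) le_rfl, d1 (n + 2) (by omega), s2, s3, s1,
    d2] at h
  linear_combination -h

theorem structure_bn (ha : a = 0) (n : ℕ) : bn (n + 1) = (n + 1) * b := by
  have h := congrArg (fun p => p.coeff (n + 1)) (hrel (n + 1))
  rw [structure_an hP hrel] at h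
  simp only [← dX_apply, ← sX_apply, coeff_add, coeff_C_mul, add_mul, prev, pow_two, mul_assoc,
    ha] at h
  have d1 := (degree_lt_iff_coeff_zero _ _).1 (dX_degree β c5 (hP.degree_lt (n + 1)))
  have s1 := sX_coeff_top β c5 (hP.degree_lt (n + 1))
  have s3 := (degree_lt_iff_coeff_zero _ _).1 (sX_degree β c5 (hP.degree_lt n)) (n + 1) le_rfl
  have d2 := dX_coeff_top β c5 (hP.degree_lt (n + 1))
  rw [hP.coeff_self] at s1 d2
  rw [coeff_X_mul, coeff_X_mul, d1 (n + 1) le_rfl, s3, s1, d2] at h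
  linear_combination -h

include hl in
-- With a pure D on the left and a pure S on the right, a functional N satisfying `N (D f) = u (P 1
-- * f)` can be applied. The correction term `S ((2az + b') f)` is expanded by the three-term
-- recurrence, which is where the combination `cₙ + 2aCₙ` comes from.
theorem structure_shifted (n : ℕ) :
    dX β c5 ((C a * X ^ 2 + C (b + 2 * a * β) * X +
        C (a * (c5 ^ 2 / 4 - 3 * β ^ 2) - b * β + c)) * P (n + 1)) =
      sX β c5 (C ((n + 3) * a) * P (n + 2) +
        C (bn (n + 1) + 2 * a * recB u P (n + 1) + (b + 2 * a * β)) * P (n + 1) +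
        C (cn (n + 1) + 2 * a * recC u P (n + 1)) * P n) := by
  have h1 := quadratic_mul_dX hl a b c (P (n + 1))
  have h2 := hrel (n + 1)
  have h3 := hP.recurrence (n + 1)
  have h4 : (C (2 * a) * X + C (b + 2 * a * β)) * P (n + 1) = C (2 * a) * P (n + 2) +
      C (2 * a * recB u P (n + 1) + (b + 2 * a * β)) * P (n + 1) +
      C (2 * a * recC u P (n + 1)) * P n := by
    rw [h3]; simp only [prev, map_add, map_mul]; ring
  rw [structure_an hP hrel, ← dX_apply, ← sX_apply, ← sX_apply, ← sX_apply] at h2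
  rw [h4] at h1
  rw [h2] at h1
  simp only [prev] at h1
  rw [eq_comm, sub_eq_iff_eq_add] at h1
  rw [h1]
  simp only [map_add (sX β c5), sX_C_mul]
  simp only [C_add, C_mul, C_ofNat, C_1]
  ring

end Structure

theorem map_C_mul_functional (u : ℂ[X] →ₗ[ℂ] ℂ) (r : ℂ) (q : ℂ[X]) : u (C r * q) = r * u q := by
  rw [← smul_eq_C_mul, map_smul, smul_eq_mul]

theorem dX_one_step (β c5 B0 : ℂ) : dX β c5 (X - C B0) = 1 := by simp

theorem sX_one_step (β c5 B0 : ℂ) : sX β c5 (X - C B0) = (X - C B0) + C β := by simp; ring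

/-! ### D and S on the polynomials of degree two and three -/

section
variable {β c5 : ℂ} (hl : (β, c5) ≠ (0, 0))
include hl

theorem dX_two_step {B0 B1 C1 : ℂ} {p1 p2 : ℂ[X]} (h1 : p1 = X - C B0)
    (h2 : p2 = (X - C B1) * p1 - C C1) :
    dX β c5 p2 = C 2 * p1 + C (B0 - B1 + 2 * β) := by
  have : p2 = X * (X - C B0) - C B1 * (X - C B0) - C C1 := by rw [h2, h1]; ring
  rw [this, h1]
  simp only [map_sub (dX β c5), dX_C_mul, dX_X_mul hl, dX_X, dX_C,
    map_sub (sX β c5), sX_X, sX_C]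
  simp only [C_add, C_mul, C_sub, C_ofNat]
  ring

theorem sX_two_step {B0 B1 C1 : ℂ} {p1 p2 : ℂ[X]} (h1 : p1 = X - C B0)
    (h2 : p2 = (X - C B1) * p1 - C C1) :
    sX β c5 p2 = p2 + C (6 * β) * p1 +
      C (6 * β * B0 + β ^ 2 + c5 ^ 2 / 4 - β * (B0 + B1)) := by
  have : p2 = X * (X - C B0) - C B1 * (X - C B0) - C C1 := by rw [h2, h1]; ring
  rw [this, h1]
  simp only [map_sub (sX β c5), sX_C_mul, sX_X_mul hl, dX_X, dX_C,
    map_sub (dX β c5), sX_X, sX_C]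
  generalize c5 ^ 2 / 4 = γ
  simp only [C_add, C_mul, C_sub, C_ofNat, C_pow]
  ring

theorem dX_three_step {B0 B1 B2 C1 C2 : ℂ} {p1 p2 p3 : ℂ[X]} (h1 : p1 = X - C B0)
    (h2 : p2 = (X - C B1) * p1 - C C1) (h3 : p3 = (X - C B2) * p2 - C C2 * p1) :
    dX β c5 p3 = C 3 * p2 + C (10 * β + B0 + B1 - 2 * B2) * p1 +
      C (3 * β ^ 2 + c5 ^ 2 / 4 - 2 * β * (B0 + B1 + B2) + (B0 * B1 + B0 * B2 + B1 * B2 - C1 - C2)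
        - 3 * (B0 * B1 - C1) + (10 * β + B0 + B1 - 2 * B2) * B0) := by
  have : p3 = X * p2 - C B2 * p2 - C C2 * p1 := by rw [h3]; ring
  rw [this]
  simp only [map_sub (dX β c5), dX_C_mul, dX_X_mul hl, dX_two_step hl h1 h2,
    sX_two_step hl h1 h2]
  rw [h2, h1, dX_one_step]
  generalize c5 ^ 2 / 4 = γ
  simp only [C_add, C_mul, C_sub, C_ofNat, C_pow]
  ring

/-- The constant term is left unspecified: the result is multiplied by `P 1` and fed to `u`, and `u
(P 1) = 0`. -/
theorem sX_three_step {B0 B1 B2 C1 C2 : ℂ} {p1 p2 p3 : ℂ[X]} (h1 : p1 = X - C B0)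
    (h2 : p2 = (X - C B1) * p1 - C C1) (h3 : p3 = (X - C B2) * p2 - C C2 * p1) :
    ∃ e : ℂ, sX β c5 p3 = p3 + C (15 * β) * p2 +
      C (15 * β ^ 2 + 3 * (c5 ^ 2 / 4) + 9 * β * (B0 + B1) - 6 * β * B2) * p1 + C e := by
  have : p3 = X * p2 - C B2 * p2 - C C2 * p1 := by rw [h3]; ring
  generalize hγ : c5 ^ 2 / 4 = γ
  let q : ℂ[X] := sX β c5 p3 - (p3 + C (15 * β) * p2 +
      C (15 * β ^ 2 + 3 * γ + 9 * β * (B0 + B1) - 6 * β * B2) * p1)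
  refine ⟨q.eval 0, ?_⟩
  have hq : q = C (q.eval 0) := by
    simp only [q]
    rw [this]
    simp only [map_sub (sX β c5), sX_C_mul, sX_X_mul hl, dX_two_step hl h1 h2,
      sX_two_step hl h1 h2]
    rw [h2, h1, sX_one_step, hγ]
    simp only [eval_add, eval_sub, eval_mul, eval_X, eval_C]
    simp only [C_add, C_mul, C_sub, C_ofNat, C_pow, C_0]
    ring
  rw [← hq]; simp only [q]; ring

end

/-! ### The Pearson-type equation for the functional -/

/-- The functional equation `⟨u, φ D_x f + ψ S_x f⟩ = 0`. -/
theorem functional_equation {β c5 : ℂ} (hl : (β, c5) ≠ (0, 0))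
    {u : ℂ[X] →ₗ[ℂ] ℂ} {P : ℕ → ℂ[X]} (hP : IsMonicOPS u P) (B Cc : ℕ → ℂ)
    (hB : B = recB u P) (hC : Cc = recC u P) (a b c : ℂ) (an bn cn : ℕ → ℂ)
    (hrel : ∀ n, (C a * X ^ 2 + C b * X + C c) * Dx β c5 (P n) =
      C (an n) * Sx β c5 (P (n + 1)) + C (bn n) * Sx β c5 (P n) + C (cn n) * Sx β c5 (prev P n))
    (hcn : ∀ n, cn n ≠ 0)
    (r₂ r₃ b' : ℂ) (hr₂ : r₂ = cn 2 + 2 * a * Cc 2) (hr₃ : r₃ = cn 3 + 2 * a * Cc 3)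
    (hb' : b' = b + 2 * a * β)
    (hcond₁ : a ≠ 0 →
      6 * a * Cc 2 * Cc 3 + 4 * r₃ * (Cc 1 - c5 ^ 2 / 4) +
        r₃ * ((B 1 - B 0) ^ 2 - 8 * β * (B 0 + B 1 - 2 * β) - 2 * Cc 2) = 0)
    (hcond₂ : a * Cc 2 * Cc 3 * (bn 2 + 2 * a * B 2 + b') -
      r₃ * (a * (B 2 + B 1) * Cc 2 + b' * Cc 2 - r₂ / 2 * (B 1 - B 0)) = 0)
    (𝔞 𝔟 : ℂ) (h𝔞 : 𝔞 = -(a * Cc 3) / r₃) (h𝔟 : 𝔟 = (B 1 - B 0 + 4 * β) / 2) :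
    r₃ ≠ 0 ∧ ∀ f, u ((C 𝔞 * P 2 - C 𝔟 * P 1 - C (Cc 1)) * dX β c5 f + P 1 * sX β c5 f) = 0 := by
  have hC0 : ∀ n, Cc n ≠ 0 := fun n => hC ▸ hP.recC_ne_zero n
  -- If a = 0 then r₃ is `cn 3`; otherwise r₃ = 0 would reduce the first side condition to 6aC₂C₃ =
  -- 0.
  have hr30 : r₃ ≠ 0 := by
    intro h
    by_cases ha : a = 0
    · rw [hr₃, ha] at h; exact hcn 3 (by linear_combination h)
    · have := hcond₁ ha
      rw [h] at this
      have h2 : a * Cc 2 * Cc 3 = 0 := by linear_combination this / 6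
      exact mul_ne_zero (mul_ne_zero ha (hC0 2)) (hC0 3) h2
  refine ⟨hr30, ?_⟩
  have hA : 𝔞 * r₃ = -(a * Cc 3) := by rw [h𝔞]; field_simp
  have p0 : P 0 = 1 := hP.zero_eq
  have hrec : ∀ n, P (n + 1) = (X - C (B n)) * P n - C (Cc n) * prev P n := fun n => by
    rw [hB, hC]; exact hP.recurrence n
  have p1 : P 1 = X - C (B 0) := by rw [hrec 0, p0]; simp [prev]
  have p2 : P 2 = (X - C (B 1)) * P 1 - C (Cc 1) := by rw [hrec 1]; simp [prev, p0]
  have p3 : P 3 = (X - C (B 2)) * P 2 - C (Cc 2) * P 1 := hrec 2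
  have hu := map_C_mul_functional u
  have hu0 : ∀ i j, i ≠ j → u (P i * P j) = 0 := hP.orthogonal
  have hu1 : ∀ n, n ≠ 0 → u (P n) = 0 := fun n hn => by
    have := hu0 n 0 hn; rwa [p0, mul_one] at this
  have hs : ∀ n, u (P (n + 1) * P (n + 1)) = Cc (n + 1) * u (P n * P n) := fun n => by
    rw [hC]; exact hP.sq_succ n
  have hne := hP.sq_ne_zero
  -- N is the antiderivative of ψu, since `P 1` is ψ. The goal is to recognise N ∘ S as a polynomial
  -- multiple of `u`.
  obtain ⟨N, hN⟩ := exists_antiderivative β c5 (u.comp (LinearMap.mulLeft ℂ (P 1))) (by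
    simp [hu1 1 one_ne_zero])
  simp only [LinearMap.comp_apply, LinearMap.mulLeft_apply] at hN
  have hF : ∀ f, N (sX β c5 (dX β c5 f)) = u (P 1 * sX β c5 f) - 2 * β * u (P 1 * dX β c5 f) := by
    intro f
    have h := dX_sX hl f
    rw [← hN, ← hN, h, map_add, map_C_mul_functional]; ring
  have hua : ∀ p q, u (p + q) = u p + u q := map_add u
  have hNa : ∀ p q, N (sX β c5 (p + q)) = N (sX β c5 p) + N (sX β c5 q) := fun p q => by
    rw [map_add, map_add]
  have hNs : ∀ (r : ℂ) (q : ℂ[X]), N (sX β c5 (C r * q)) = r * N (sX β c5 q) := fun r q => by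
    rw [sX_C_mul, map_C_mul_functional]
  -- values at the polynomials of low degree
  have d2 := dX_two_step hl p1 p2
  have d3 := dX_three_step hl p1 p2 p3
  have s2 := sX_two_step hl p1 p2
  obtain ⟨e, s3⟩ := sX_three_step hl p1 p2 p3
  have F0 : N (sX β c5 1) = u (P 1 * P 1) := by
    have h := hF (P 1)
    rw [p1, dX_one_step, sX_one_step, ← p1, mul_one, hu1 1 one_ne_zero, mul_add, map_add,
      mul_comm _ (C β), hu, hu1 1 one_ne_zero] at h
    rw [h]; ring
  have F1 : N (sX β c5 (P 1)) = (B 1 - B 0) / 2 * u (P 1 * P 1) := by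
    have h := hF (P 2)
    have e1 : P 1 * sX β c5 (P 2) = P 1 * P 2 + C (6 * β) * (P 1 * P 1) +
      C (6 * β * B 0 + β ^ 2 + c5 ^ 2 / 4 - β * (B 0 + B 1)) * P 1 := by rw [s2]; ring
    have e2 : P 1 * dX β c5 (P 2) = C 2 * (P 1 * P 1) + C (B 0 - B 1 + 2 * β) * P 1 := by
      rw [d2]; ring
    have h' : N (sX β c5 (dX β c5 (P 2))) = 2 * N (sX β c5 (P 1)) +
        (B 0 - B 1 + 2 * β) * N (sX β c5 1) := by
      rw [d2, ← hNs, ← hNs, ← hNa, mul_one]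
    rw [h', e1, e2, hua, hua, hua, hu, hu, hu, hu, F0, hu0 1 2 (by norm_num),
      hu1 1 one_ne_zero] at h
    linear_combination h / 2
  -- the recurrence
  have key : ∀ n, (n + 3) * a * N (sX β c5 (P (n + 2))) +
      (bn (n + 1) + 2 * a * B (n + 1) + b') * N (sX β c5 (P (n + 1))) +
      (cn (n + 1) + 2 * a * Cc (n + 1)) * N (sX β c5 (P n)) =
      a * u (P 3 * P (n + 1)) + (a * (B 1 + B 2) + b') * u (P 2 * P (n + 1)) +
      (a * (Cc 2 + B 1 ^ 2 + Cc 1) + b' * B 1 + (a * (c5 ^ 2 / 4 - 3 * β ^ 2) - b * β + c)) *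
        u (P 1 * P (n + 1)) := by
    intro n
    have h := structure_shifted hl hP hrel n
    have h1 := congrArg N h
    rw [hN, ← hB, ← hC, hNa, hNa, hNs, hNs, hNs, ← hb'] at h1
    rw [← h1]
    generalize a * (c5 ^ 2 / 4 - 3 * β ^ 2) - b * β + c = c'
    have e1 : P 1 * ((C a * X ^ 2 + C b' * X + C c') * P (n + 1)) = C a * (P 3 * P (n + 1)) +
      C (a * (B 1 + B 2) + b') * (P 2 * P (n + 1)) +
      C (a * (Cc 2 + B 1 ^ 2 + Cc 1) + b' * B 1 + c') * (P 1 * P (n + 1)) +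
      C (a * (B 1 * Cc 1 + Cc 1 * B 0) + b' * Cc 1) * P (n + 1) := by
      rw [p3, p2, p1]
      simp only [C_add, C_mul, C_pow]
      ring
    rw [e1, hua, hua, hua, hu, hu, hu, hu, hu1 _ n.succ_ne_zero]
    ring
  -- For a = 0 the value is 0: if b = 0 it follows from `cn 3 ≠ 0`, and if b ≠ 0 from the second
  -- side condition. For a ≠ 0, `hF` at `P 3` computes the value, and the first side condition turns
  -- it into the stated form.
  have F2 : N (sX β c5 (P 2)) = -𝔞 * Cc 2 * u (P 1 * P 1) := by
    by_cases ha : a = 0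
    · have hb1 : b' = b := by rw [hb', ha]; ring
      have k1 := key 1
      have k2 := key 2
      norm_num only at k1 k2
      rw [hu0 3 2 (by norm_num), hu0 1 2 (by norm_num), F1, hs 1, structure_bn hP hrel ha 1] at k1
      rw [hu0 2 3 (by norm_num), hu0 1 3 (by norm_num), structure_bn hP hrel ha 2] at k2
      simp only [ha, zero_mul, zero_add, mul_zero, zero_sub, neg_eq_zero, add_zero, hb1] at k1 k2 hcond₂
      norm_num at k1 k2
      have hz := (mul_eq_zero.1 hcond₂).resolve_left hr30
      rw [hr₂, ha] at hz
      have hA0 : 𝔞 = 0 := by rw [h𝔞, ha]; simp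
      rw [hA0]
      by_cases hb0 : b = 0
      · rw [hb0] at k2
        have := (mul_eq_zero.1 (by linear_combination k2 : cn 3 * N (sX β c5 (P 2)) = 0)).resolve_left
          (hcn 3)
        rw [this]; ring
      · have : 3 * b * N (sX β c5 (P 2)) = 0 := by
          linear_combination k1 + u (P 1 * P 1) * hz
        rw [(mul_eq_zero.1 this).resolve_left (mul_ne_zero three_ne_zero hb0)]; ring
    · have h := hF (P 3)
      have e1 : P 1 * sX β c5 (P 3) = P 1 * P 3 + C (15 * β) * (P 1 * P 2) +
        C (15 * β ^ 2 + 3 * (c5 ^ 2 / 4) + 9 * β * (B 0 + B 1) - 6 * β * B 2) * (P 1 * P 1) +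
          C e * P 1 := by rw [s3]; ring
      have e2 : P 1 * dX β c5 (P 3) = C 3 * (P 1 * P 2) +
          C (10 * β + B 0 + B 1 - 2 * B 2) * (P 1 * P 1) +
          C (3 * β ^ 2 + c5 ^ 2 / 4 - 2 * β * (B 0 + B 1 + B 2) +
          (B 0 * B 1 + B 0 * B 2 + B 1 * B 2 - Cc 1 - Cc 2)
        - 3 * (B 0 * B 1 - Cc 1) + (10 * β + B 0 + B 1 - 2 * B 2) * B 0) * P 1 := by
        rw [d3]; ring
      have h' : N (sX β c5 (dX β c5 (P 3))) = 3 * N (sX β c5 (P 2)) +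
          (10 * β + B 0 + B 1 - 2 * B 2) * N (sX β c5 (P 1)) +
          (3 * β ^ 2 + c5 ^ 2 / 4 - 2 * β * (B 0 + B 1 + B 2) +
          (B 0 * B 1 + B 0 * B 2 + B 1 * B 2 - Cc 1 - Cc 2)
        - 3 * (B 0 * B 1 - Cc 1) + (10 * β + B 0 + B 1 - 2 * B 2) * B 0) * N (sX β c5 1) := by
        rw [d3, ← hNs, ← hNs, ← hNs, ← hNa, ← hNa, mul_one]
      rw [h', e1, e2, hua, hua, hua, hua, hua, hu, hu, hu, hu, hu, hu, F0, F1,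
        hu0 1 2 (by norm_num), hu0 1 3 (by norm_num), hu1 1 one_ne_zero] at h
      have h1 := hcond₁ ha
      have h2 : -6 * 𝔞 * Cc 2 + 4 * (Cc 1 - c5 ^ 2 / 4) +
        ((B 1 - B 0) ^ 2 - 8 * β * (B 0 + B 1 - 2 * β) - 2 * Cc 2) = 0 := by
        refine mul_left_cancel₀ hr30 ?_
        linear_combination h1 - 6 * Cc 2 * hA
      linear_combination h / 3 - u (P 1 * P 1) * h2 / 6
  -- For a = 0 the recurrence has two terms: with b = 0 it is solved for the lower one, with b ≠ 0
  -- for the upper one, starting from the vanishing at `P 2`. For a ≠ 0 it has three terms and two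
  -- consecutive zeros are needed.
  have F3 : ∀ n, N (sX β c5 (P (n + 3))) = 0 := by
    by_cases ha : a = 0
    · have hA0 : 𝔞 = 0 := by rw [h𝔞, ha]; simp
      have hb1 : b' = b := by rw [hb', ha]; ring
      have k : ∀ n, (n + 3) * b * N (sX β c5 (P (n + 2))) +
          cn (n + 2) * N (sX β c5 (P (n + 1))) = b * u (P 2 * P (n + 2)) +
          (b * B 1 - b * β + c) * u (P 1 * P (n + 2)) := by
        intro n
        have := key (n + 1)
        rw [structure_bn hP hrel ha, ha, hb1] at this
        push_cast at this
        linear_combination this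
      by_cases hb0 : b = 0
      · intro n
        have := k (n + 2)
        rw [hb0, hu0 1 _ (by omega)] at this
        exact (mul_eq_zero.1 (by linear_combination this)).resolve_left (hcn (n + 4))
      · suffices h : ∀ n, N (sX β c5 (P (n + 2))) = 0 from fun n => h (n + 1)
        intro n
        induction n with
        | zero => rw [F2, hA0]; ring
        | succ n ih =>
          have := k (n + 1)
          rw [ih, hu0 1 _ (by omega), hu0 2 _ (by omega)] at this
          have h3 : ((n : ℂ) + 4) * b ≠ 0 := mul_ne_zero (by exact_mod_cast (by omega : n + 4 ≠ 0)) hb0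
          refine (mul_eq_zero.1 ?_).resolve_left h3
          push_cast at this
          linear_combination this
    · have hn : ∀ n : ℕ, ((n : ℂ) + 3) * a ≠ 0 := fun n =>
        mul_ne_zero (by exact_mod_cast (by omega : n + 3 ≠ 0)) ha
      -- After multiplication by r₃ the remaining terms are exactly the second side condition.
      have z3 : N (sX β c5 (P 3)) = 0 := by
        refine (mul_eq_zero.1 ?_).resolve_left (hn 1)
        have k1 := key 1
        rw [hu0 3 2 (by norm_num), hu0 1 2 (by norm_num), F2, F1, hs 1, ← hr₂] at k1
        refine mul_left_cancel₀ hr30 ?_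
        linear_combination r₃ * k1 + (bn 2 + 2 * a * B 2 + b') * Cc 2 * u (P 1 * P 1) * hA
          - u (P 1 * P 1) * hcond₂
      -- The remaining terms cancel by the choice of 𝔞, in the form 𝔞 r₃ = -aC₃.
      have z4 : N (sX β c5 (P 4)) = 0 := by
        refine (mul_eq_zero.1 ?_).resolve_left (hn 2)
        have k1 := key 2
        rw [hu0 2 3 (by norm_num), hu0 1 3 (by norm_num), F2, z3, hs 2, hs 1, ← hr₃] at k1
        linear_combination k1 + Cc 2 * u (P 1 * P 1) * hA
      suffices h : ∀ n, N (sX β c5 (P (n + 3))) = 0 ∧ N (sX β c5 (P (n + 4))) = 0 from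
        fun n => (h n).1
      intro n
      induction n with
      | zero => exact ⟨z3, z4⟩
      | succ n ih =>
        refine ⟨ih.2, ?_⟩
        refine (mul_eq_zero.1 ?_).resolve_left (hn (n + 3))
        have k1 := key (n + 3)
        rw [hu0 1 _ (by omega), hu0 2 _ (by omega), hu0 3 _ (by omega), ih.1, ih.2] at k1
        linear_combination k1
  -- comparison with the multiple of `u` by `φ + 2 β ψ`
  let H : ℂ[X] →ₗ[ℂ] ℂ := N.comp (sX β c5) +
    u.comp (LinearMap.mulLeft ℂ (C 𝔞 * P 2 - C 𝔟 * P 1 - C (Cc 1) + C (2 * β) * P 1))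
  have hHapp : ∀ f, H f = N (sX β c5 f) + (𝔞 * u (P 2 * f) - 𝔟 * u (P 1 * f) - Cc 1 * u f +
      2 * β * u (P 1 * f)) := by
    intro f
    simp only [H, LinearMap.add_apply, LinearMap.comp_apply, LinearMap.mulLeft_apply]
    rw [← hu, ← hu, ← hu, ← hu, ← map_sub, ← map_sub, ← map_add]
    congr 2; ring
  have hH : ∀ n, H (P n) = 0 := by
    intro n
    rw [hHapp]
    match n with
    | 0 =>
      rw [hu0 2 0 (by norm_num), hu0 1 0 (by norm_num), p0, F0, hs 0, p0, mul_one]; ring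
    | 1 =>
      rw [hu0 2 1 (by norm_num), hu1 1 (by norm_num), F1, h𝔟]; ring
    | 2 =>
      rw [hu0 1 2 (by norm_num), hu1 2 (by norm_num), F2, hs 1]; ring
    | n + 3 =>
      rw [hu0 1 _ (by omega), hu0 2 _ (by omega), hu1 _ (by omega), F3]; ring
  intro f
  -- On the image of D, `hF` expresses N ∘ S through `u`; its -2β term cancels the extra 2βψ in the
  -- multiplier.
  have h1 := hP.ext_functional hH (dX β c5 f)
  rw [hHapp, hF] at h1
  have e1 : (C 𝔞 * P 2 - C 𝔟 * P 1 - C (Cc 1)) * dX β c5 f + P 1 * sX β c5 f =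
    C 𝔞 * (P 2 * dX β c5 f) - C 𝔟 * (P 1 * dX β c5 f) - C (Cc 1) * dX β c5 f +
      P 1 * sX β c5 f := by ring
  rw [e1, hua, map_sub, map_sub, hu, hu, hu]
  linear_combination h1

/-! ### The second-order operator L, its commutator M with z, and their adjoints -/

/-- The operator `φ D_x² + ψ S_x D_x`. -/
noncomputable def opL (β c5 : ℂ) (φ ψ : ℂ[X]) : ℂ[X] →ₗ[ℂ] ℂ[X] :=
  (LinearMap.mulLeft ℂ φ).comp ((dX β c5).comp (dX β c5)) +
    (LinearMap.mulLeft ℂ ψ).comp ((sX β c5).comp (dX β c5))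

theorem opL_apply (β c5 : ℂ) (φ ψ f : ℂ[X]) :
    opL β c5 φ ψ f = φ * dX β c5 (dX β c5 f) + ψ * sX β c5 (dX β c5 f) := rfl

/-- The commutator of `opL` with multiplication by the variable. -/
noncomputable def opM (β c5 : ℂ) (φ ψ f : ℂ[X]) : ℂ[X] :=
  opL β c5 φ ψ (X * f) - X * opL β c5 φ ψ f

theorem opL_C_mul (β c5 : ℂ) (φ ψ : ℂ[X]) (r : ℂ) (f : ℂ[X]) :
    opL β c5 φ ψ (C r * f) = C r * opL β c5 φ ψ f := by
  rw [← smul_eq_C_mul, map_smul, smul_eq_C_mul]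

/-- The eigenvalue `n (1 + (n - 1) 𝔞)`. -/
noncomputable def eigval (𝔞 : ℂ) (n : ℕ) : ℂ := (n : ℂ) * (1 + ((n : ℂ) - 1) * 𝔞)

section Commutators
variable {β c5 : ℂ} (hl : (β, c5) ≠ (0, 0)) (φ ψ : ℂ[X])
include hl

theorem dX_dX_X_mul (f : ℂ[X]) : dX β c5 (dX β c5 (X * f)) =
    X * dX β c5 (dX β c5 f) + C 2 * sX β c5 (dX β c5 f) + C (4 * β) * dX β c5 (dX β c5 f) := by
  have e : dX β c5 (X * f) = X * dX β c5 f + C β * dX β c5 f + sX β c5 f := by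
    rw [dX_X_mul hl]; ring
  rw [e, map_add, map_add, dX_C_mul, dX_X_mul hl, dX_sX hl]
  simp only [C_mul, C_ofNat]; ring

theorem sX_dX_X_mul (f : ℂ[X]) : sX β c5 (dX β c5 (X * f)) =
    X * sX β c5 (dX β c5 f) + C 2 * ((C (4 * β) * X + C (c5 ^ 2 / 4)) * dX β c5 (dX β c5 f)) +
      C (4 * β) * sX β c5 (dX β c5 f) + f := by
  have e : dX β c5 (X * f) = X * dX β c5 f + C β * dX β c5 f + sX β c5 f := by
    rw [dX_X_mul hl]; ring
  rw [e, map_add, map_add, sX_C_mul, sX_X_mul hl, sX_sX hl]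
  simp only [C_mul, C_ofNat]; ring

theorem opM_eq (f : ℂ[X]) : opM β c5 φ ψ f = C 2 * φ * sX β c5 (dX β c5 f) +
    C 2 * ψ * (C (4 * β) * X + C (c5 ^ 2 / 4)) * dX β c5 (dX β c5 f) +
      C (4 * β) * opL β c5 φ ψ f + ψ * f := by
  rw [opM, opL_apply, opL_apply, dX_dX_X_mul hl, sX_dX_X_mul hl]
  ring

/-- Commuting z past M produces only L, M and a multiplication operator, so no further commutators
are needed in the adjoint computation. -/
theorem opM_X_mul (f : ℂ[X]) : opM β c5 φ ψ (X * f) = X * opM β c5 φ ψ f +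
    (C (16 * β) * X + C (4 * (c5 ^ 2 / 4) - 16 * β ^ 2)) * opL β c5 φ ψ f +
      C (8 * β) * opM β c5 φ ψ f + (C 2 * φ - C (4 * β) * ψ) * f := by
  rw [opM_eq hl, opM_eq hl, opL_apply, opL_apply, dX_dX_X_mul hl, sX_dX_X_mul hl]
  generalize c5 ^ 2 / 4 = γ
  simp only [C_sub, C_mul, C_ofNat, C_pow]; ring

end Commutators

section Adjoint
variable {β c5 : ℂ} (hl : (β, c5) ≠ (0, 0)) {φ ψ : ℂ[X]} {u : ℂ[X] →ₗ[ℂ] ℂ}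
  (hu : ∀ f, u (φ * dX β c5 f + ψ * sX β c5 f) = 0)
include hl hu

/-- By the rules for DS and SS, M f = 2(φ D(Sf) + ψ S(Sf)) - ψ f, and the Pearson equation at S f
kills the bracket. -/
theorem functional_opM (f : ℂ[X]) : u (opM β c5 φ ψ f) = -u (ψ * f) := by
  have h1 := hu (sX β c5 f)
  have h2 := hu (dX β c5 f)
  rw [dX_sX hl, sX_sX hl] at h1
  have e : opM β c5 φ ψ f = C 2 * (φ * (sX β c5 (dX β c5 f) + C (2 * β) * dX β c5 (dX β c5 f)) +
      ψ * (f + C (2 * β) * sX β c5 (dX β c5 f) + (C (4 * β) * X + C (c5 ^ 2 / 4)) *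
      dX β c5 (dX β c5 f))) - ψ * f := by
    rw [opM_eq hl, opL_apply]
    simp only [C_mul, C_ofNat]; ring
  rw [e, map_sub, map_C_mul_functional, h1]
  ring

/-- L and M have to be treated together, because z^(k+1) L f = z^k L(zf) - z^k M f. The point is the
degree bound: the adjoint of L does not raise degrees, that of M raises them by at most one. -/
theorem exists_adjoint (hφ : φ.degree < 3) (hψ : ψ.degree < 2) (k : ℕ) :
    ∃ q m : ℂ[X], q.degree < ((k + 1 : ℕ) : WithBot ℕ) ∧ m.degree < ((k + 2 : ℕ) : WithBot ℕ) ∧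
      ∀ f, u (X ^ k * opL β c5 φ ψ f) = u (q * f) ∧ u (X ^ k * opM β c5 φ ψ f) = u (m * f) := by
  induction k with
  | zero =>
    refine ⟨0, -ψ, by simp, by simpa using hψ, fun f => ?_⟩
    rw [pow_zero, one_mul, one_mul, functional_opM hl hu, neg_mul, map_neg, zero_mul, map_zero,
      opL_apply, hu]
    exact ⟨rfl, rfl⟩
  | succ k ih =>
    obtain ⟨q, m, hq, hm, h⟩ := ih
    have hq' : ∀ f, u (X ^ (k + 1) * opL β c5 φ ψ f) = u ((X * q - m) * f) := by
      intro f
      have e : X ^ (k + 1) * opL β c5 φ ψ f =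
        X ^ k * opL β c5 φ ψ (X * f) - X ^ k * opM β c5 φ ψ f := by rw [opM]; ring
      rw [e, map_sub, (h _).1, (h _).2, ← map_sub]; congr 1; ring
    refine ⟨X * q - m, X * m - C (16 * β) * (X * q - m) - C (4 * (c5 ^ 2 / 4) - 16 * β ^ 2) * q -
      C (8 * β) * m - X ^ k * (C 2 * φ - C (4 * β) * ψ), ?_, ?_, fun f => ⟨hq' f, ?_⟩⟩
    · rw [degree_lt_iff_coeff_zero] at *
      intro i hi
      obtain ⟨i, rfl⟩ : ∃ j, i = j + 1 := ⟨i - 1, by omega⟩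
      rw [coeff_sub, coeff_X_mul, hq i (by omega), hm (i + 1) (by omega), sub_zero]
    · have hφ' := fun i => (degree_lt_iff_coeff_zero φ 3).1 hφ i
      have hψ' := fun i => (degree_lt_iff_coeff_zero ψ 2).1 hψ i
      rw [degree_lt_iff_coeff_zero] at *
      intro i hi
      obtain ⟨i, rfl⟩ : ∃ j, i = j + (k + 1) + 2 := ⟨i - k - 3, by omega⟩
      simp only [coeff_sub, coeff_C_mul]
      rw [show i + (k + 1) + 2 = i + 3 + k by ring, coeff_X_pow_mul,
        show i + 3 + k = (i + 2 + k) + 1 by ring, coeff_X_mul, coeff_X_mul, coeff_sub, coeff_C_mul,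
        coeff_C_mul, hq _ (by omega), hq _ (by omega), hm _ (by omega), hm _ (by omega),
        hφ' _ (by omega), hψ' _ (by omega)]
      ring
    · have e : X ^ (k + 1) * opM β c5 φ ψ f = X ^ k * opM β c5 φ ψ (X * f) -
          C (16 * β) * (X ^ (k + 1) * opL β c5 φ ψ f) -
          C (4 * (c5 ^ 2 / 4) - 16 * β ^ 2) * (X ^ k * opL β c5 φ ψ f) -
          C (8 * β) * (X ^ k * opM β c5 φ ψ f) - X ^ k * (C 2 * φ - C (4 * β) * ψ) * f := by
        rw [opM_X_mul hl]; ring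
      rw [e, map_sub, map_sub, map_sub, map_sub, map_C_mul_functional, map_C_mul_functional,
        map_C_mul_functional, hq', (h _).1, (h _).2, (h _).2, ← map_C_mul_functional,
        ← map_C_mul_functional, ← map_C_mul_functional, ← map_sub, ← map_sub, ← map_sub, ← map_sub]
      congr 1; ring

end Adjoint

section Degree
variable (β c5 𝔞 p r q : ℂ)

theorem opL_degree {f : ℂ[X]} {n : ℕ} (hf : f.degree < ((n + 1 : ℕ) : WithBot ℕ)) :
    (opL β c5 (C 𝔞 * X ^ 2 + C p * X + C r) (X + C q) f).degree < ((n + 1 : ℕ) : WithBot ℕ) ∧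
    (opL β c5 (C 𝔞 * X ^ 2 + C p * X + C r) (X + C q) f).coeff n = eigval 𝔞 n * f.coeff n := by
  have d1 := dX_degree β c5 hf
  have s1 := sX_degree β c5 d1
  have hco : ∀ m, (opL β c5 (C 𝔞 * X ^ 2 + C p * X + C r) (X + C q) f).coeff m =
    𝔞 * (X * (X * dX β c5 (dX β c5 f))).coeff m + p * (X * dX β c5 (dX β c5 f)).coeff m +
      r * (dX β c5 (dX β c5 f)).coeff m + (X * sX β c5 (dX β c5 f)).coeff m +
      q * (sX β c5 (dX β c5 f)).coeff m := fun m => by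
    rw [opL_apply, ← coeff_C_mul, ← coeff_C_mul, ← coeff_C_mul, ← coeff_C_mul, ← coeff_add,
      ← coeff_add, ← coeff_add, ← coeff_add]
    congr 1; ring
  -- For n = 0 and n = 1 the second difference vanishes and top coefficients of D² are not
  -- available.
  rcases n with _ | _ | n
  · have h0 : dX β c5 f = 0 := by simpa using d1
    rw [opL_apply, h0]
    simp [eigval]
  · have h0 : dX β c5 (dX β c5 f) = 0 := by simpa using dX_degree β c5 d1
    have t1 := dX_coeff_top β c5 hf
    have t2 := sX_coeff_top β c5 d1
    refine ⟨?_, ?_⟩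
    · rw [degree_lt_iff_coeff_zero] at *
      intro i hi
      obtain ⟨i, rfl⟩ : ∃ j, i = j + 1 := ⟨i - 1, by omega⟩
      rw [hco, h0]
      simp [s1 i (by omega), s1 (i + 1) (by omega)]
    · have s0 := (degree_lt_iff_coeff_zero _ _).1 s1 1 le_rfl
      rw [zero_add] at t1 ⊢
      have hX : ∀ g : ℂ[X], (X * g).coeff 1 = g.coeff 0 := fun g => coeff_X_mul g 0
      rw [hco, h0, s0, hX (sX β c5 (dX β c5 f)), t2, t1]
      simp [eigval]
  · have d2 := dX_degree β c5 d1
    have t1 := dX_coeff_top β c5 hf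
    have t2 := sX_coeff_top β c5 d1
    have t3 := dX_coeff_top β c5 d1
    refine ⟨?_, ?_⟩
    · rw [degree_lt_iff_coeff_zero] at *
      intro i hi
      obtain ⟨i, rfl⟩ : ∃ j, i = j + 2 := ⟨i - 2, by omega⟩
      rw [hco, coeff_X_mul, coeff_X_mul, coeff_X_mul, coeff_X_mul, d2 i (by omega),
        d2 (i + 1) (by omega), d2 (i + 2) (by omega), s1 (i + 1) (by omega), s1 (i + 2) (by omega)]
      simp
    · rw [degree_lt_iff_coeff_zero] at s1 d2
      rw [hco, coeff_X_mul, coeff_X_mul, coeff_X_mul, coeff_X_mul, t3, t2, t1,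
        d2 (n + 1) (by omega), d2 (n + 2) (by omega), s1 (n + 1 + 1) (by omega)]
      simp only [eigval]; push_cast; ring

/-- A polynomial of degree `n` is determined by the eigenvalue equation. -/
theorem opL_unique (hd : ∀ k : ℕ, 1 + (k : ℂ) * 𝔞 ≠ 0) {n : ℕ} {g : ℂ[X]}
    (hg : g.degree < (n : WithBot ℕ))
    (h : opL β c5 (C 𝔞 * X ^ 2 + C p * X + C r) (X + C q) g = C (eigval 𝔞 n) * g) : g = 0 := by
  by_contra hne
  have hm : g.natDegree < n := by rwa [degree_eq_natDegree hne, Nat.cast_lt] at hg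
  have hlt : g.degree < ((g.natDegree + 1 : ℕ) : WithBot ℕ) :=
    lt_of_le_of_lt degree_le_natDegree (by exact_mod_cast Nat.lt_succ_self _)
  have h1 := (opL_degree β c5 𝔞 p r q hlt).2
  rw [h, coeff_C_mul] at h1
  have h2 := mul_right_cancel₀ (leadingCoeff_ne_zero.2 hne) h1
  obtain ⟨k, hk⟩ := Nat.exists_eq_add_of_lt hm
  have h3 : ((k : ℂ) + 1) * (1 + ((2 * g.natDegree + k : ℕ) : ℂ) * 𝔞) = 0 := by
    simp only [eigval] at h2
    rw [hk] at h2
    push_cast at h2 ⊢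
    linear_combination h2
  rcases mul_eq_zero.1 h3 with h4 | h4
  · exact k.succ_ne_zero (by exact_mod_cast h4)
  · exact hd _ h4

end Degree

/-! ### The eigenvalue equation and the distinctness of the eigenvalues -/

section Eigen
variable {β c5 : ℂ} (hl : (β, c5) ≠ (0, 0)) {u : ℂ[X] →ₗ[ℂ] ℂ} {P : ℕ → ℂ[X]}
  (hP : IsMonicOPS u P) {𝔞 p r q : ℂ}
  (hu : ∀ f, u ((C 𝔞 * X ^ 2 + C p * X + C r) * dX β c5 f + (X + C q) * sX β c5 f) = 0)
include hl hP hu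

theorem opL_eigen (n : ℕ) :
    opL β c5 (C 𝔞 * X ^ 2 + C p * X + C r) (X + C q) (P n) = C (eigval 𝔞 n) * P n := by
  have hφ : (C 𝔞 * X ^ 2 + C p * X + C r : ℂ[X]).degree < 3 :=
    lt_of_le_of_lt degree_quadratic_le (by norm_num)
  have hψ : (X + C q : ℂ[X]).degree < 2 := by rw [degree_X_add_C]; norm_num
  have hd := opL_degree β c5 𝔞 p r q (hP.degree_lt n)
  rw [hP.coeff_self, mul_one] at hd
  refine sub_eq_zero.1 (hP.eq_zero n _ ?_ fun k hk => ?_)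
  · have h1 := hP.degree_lt n
    have h2 := hd.1
    rw [degree_lt_iff_coeff_zero] at *
    intro i hi
    rw [coeff_sub, coeff_C_mul]
    rcases hi.eq_or_lt with rfl | h
    · rw [hd.2, hP.coeff_self]; ring
    · rw [h2 i h, h1 i h]; ring
  -- Against z^i with i < n, moving L to the adjoint side leaves a polynomial of degree at most i,
  -- which is orthogonal to `P n`.
  · rw [sub_mul, map_sub, mul_assoc, map_C_mul_functional, hP.orthogonal n k (by omega), mul_zero,
      sub_zero, (P k).as_sum_range_C_mul_X_pow, hP.natDegree_eq, Finset.mul_sum, map_sum]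
    refine Finset.sum_eq_zero fun i hi => ?_
    have hi' : i < n := by have := Finset.mem_range.1 hi; omega
    obtain ⟨q', m', hq, -, h⟩ := exists_adjoint hl hu hφ hψ i
    rw [mul_left_comm, map_C_mul_functional, mul_comm _ (X ^ i), (h _).1,
      hP.orth_of_degree_lt n (i + 1) (by omega) _ hq]
    simp

/-- Otherwise λ_{k+1} = 0, so g = D P_{k+1} is a nonzero solution of φ Dg + ψ Sg = 0. Together with
the Pearson equation this would force the product of g at x(s+1/2) and x(s-1/2) to vanish
identically. -/
theorem eigen_admissible (k : ℕ) : 1 + (k : ℂ) * 𝔞 ≠ 0 := by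
  intro hk
  have h𝔞 : 𝔞 ≠ 0 := by rintro rfl; simp at hk
  set φ : ℂ[X] := C 𝔞 * X ^ 2 + C p * X + C r with hφ
  set ψ : ℂ[X] := X + C q with hψ
  have he : eigval 𝔞 (k + 1) = 0 := by
    simp only [eigval]; push_cast; linear_combination (k + 1 : ℂ) * hk
  have h1 := opL_eigen hl hP hu (k + 1)
  rw [he, C_0, zero_mul, opL_apply] at h1
  set g := dX β c5 (P (k + 1)) with hg
  have hgd : g.degree < ((k + 1 : ℕ) : WithBot ℕ) := dX_degree β c5 (hP.degree_lt _)
  have hgk : g.coeff k = k + 1 := by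
    rw [hg, dX_coeff_top β c5 (hP.degree_lt (k + 1)), hP.coeff_self, mul_one]
  have hg0 : g ≠ 0 := by
    intro h
    rw [h, coeff_zero] at hgk
    exact k.succ_ne_zero (by exact_mod_cast hgk.symm)
  -- The Pearson equation at g·f: the terms in S f drop out by `h1`, and D f is arbitrary because D
  -- is onto.
  have h2 : φ * sX β c5 g + ψ * ((C (4 * β) * X + C (c5 ^ 2 / 4)) * dX β c5 g) = 0 := by
    refine hP.eq_zero_of_forall fun f => ?_
    obtain ⟨f, rfl⟩ := dX_surjective β c5 f
    have h3 := hu (g * f)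
    rw [dX_mul hl, sX_mul hl] at h3
    have e : (φ * sX β c5 g + ψ * ((C (4 * β) * X + C (c5 ^ 2 / 4)) * dX β c5 g)) * dX β c5 f =
      φ * (dX β c5 g * sX β c5 f + sX β c5 g * dX β c5 f) + ψ * (sX β c5 g * sX β c5 f +
        (C (4 * β) * X + C (c5 ^ 2 / 4)) * (dX β c5 g * dX β c5 f)) := by
      linear_combination -sX β c5 f * h1
    rw [e, h3]
  have h3 : φ * ((sX β c5 g) ^ 2 - (C (4 * β) * X + C (c5 ^ 2 / 4)) * (dX β c5 g) ^ 2) = 0 := by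
    linear_combination sX β c5 g * h2 - (C (4 * β) * X + C (c5 ^ 2 / 4)) * dX β c5 g * h1
  have hφ0 : φ ≠ 0 := by
    intro h
    have := congrArg (fun f => f.coeff 2) h
    simp [hφ] at this
    exact h𝔞 this
  have h4 := (mul_eq_zero.1 h3).resolve_left hφ0
  -- (Sg)² - (4βz + 𝔠₅²/4)(Dg)² is mean squared minus half-difference squared, that is, the product
  -- of the two shifted values of g.
  have h5 : (g.comp (C (4 * β) * (X + C (1 / 2)) ^ 2 + C c5 * (X + C (1 / 2)))) *
      (g.comp (C (4 * β) * (X - C (1 / 2)) ^ 2 + C c5 * (X - C (1 / 2)))) = 0 := by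
    refine Polynomial.funext fun s => ?_
    have h6 := congrArg (fun f => f.eval (lattice β c5 s)) h4
    have h7 := Dx_spec β c5 s g
    simp only [eval_sub, eval_mul, eval_pow, eval_add, eval_C, eval_X, sX_apply, dX_apply, Sx_spec,
      eval_zero] at h6
    have h8 : 4 * β * lattice β c5 s + c5 ^ 2 / 4 =
      ((lattice β c5 (s + 1 / 2) - lattice β c5 (s - 1 / 2)) / 2) ^ 2 := by
      simp only [lattice]; ring
    rw [h8] at h6
    simp only [eval_mul, eval_comp, eval_add, eval_sub, eval_C, eval_X, eval_pow, eval_zero]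
    change g.eval (lattice β c5 (s + 1 / 2)) * g.eval (lattice β c5 (s - 1 / 2)) = 0
    linear_combination h6 + (1 / 4) * ((Dx β c5 g).eval (lattice β c5 s) *
      (lattice β c5 (s + 1 / 2) - lattice β c5 (s - 1 / 2)) +
      (eval (lattice β c5 (s + 1 / 2)) g - eval (lattice β c5 (s - 1 / 2)) g)) * h7
  have hnc : ∀ t : ℂ, g.comp (C (4 * β) * (X + C t) ^ 2 + C c5 * (X + C t)) ≠ 0 := by
    intro t h
    rcases comp_eq_zero_iff.1 h with h | ⟨-, h⟩
    · exact hg0 h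
    · have h' := congrArg (fun f => f.comp (X - C t)) h
      simp only [add_comp, mul_comp, C_comp, pow_comp, X_comp, sub_add_cancel] at h'
      have e1 := congrArg (fun f => f.coeff 1) h'
      have e2 := congrArg (fun f => f.coeff 2) h'
      simp only [coeff_add, coeff_C_mul, coeff_X, coeff_C, coeff_X_pow] at e1 e2
      norm_num at e1 e2
      exact hl (by simp [e1, e2])
  rcases mul_eq_zero.1 h5 with h | h
  · exact hnc _ h
  · refine hnc (-(1 / 2)) ?_
    rw [C_neg, ← sub_eq_add_neg]; exact h

end Eigen

/-! ### Prescribed elementary symmetric functions and Pochhammer symbols -/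

theorem exists_roots_two (e₁ e₂ : ℂ) : ∃ a b : ℂ, a + b = e₁ ∧ a * b = e₂ := by
  obtain ⟨a, ha⟩ := IsAlgClosed.exists_eq_mul_self (e₁ ^ 2 - 4 * e₂)
  exact ⟨(e₁ + a) / 2, (e₁ - a) / 2, by ring, by linear_combination ha / 4⟩

theorem exists_roots_three (e₁ e₂ e₃ : ℂ) : ∃ a b c : ℂ,
    a + b + c = e₁ ∧ a * b + a * c + b * c = e₂ ∧ a * b * c = e₃ := by
  have hd : (X ^ 3 - C e₁ * X ^ 2 + C e₂ * X - C e₃ : ℂ[X]).degree = 3 := by compute_degree!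
  obtain ⟨a, ha⟩ := IsAlgClosed.exists_root _ (by rw [hd]; norm_num :
    (X ^ 3 - C e₁ * X ^ 2 + C e₂ * X - C e₃ : ℂ[X]).degree ≠ 0)
  simp only [IsRoot.def, eval_add, eval_sub, eval_mul, eval_pow, eval_X, eval_C] at ha
  obtain ⟨b, c, h1, h2⟩ := exists_roots_two (e₁ - a) (e₂ - a * (e₁ - a))
  exact ⟨a, b, c, by linear_combination h1, by linear_combination a * h1 + h2,
    by linear_combination ha + a * h2⟩

theorem exists_roots_four (e₁ e₂ e₃ e₄ : ℂ) : ∃ a b c d : ℂ, a + b + c + d = e₁ ∧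
    a * b + a * c + a * d + b * c + b * d + c * d = e₂ ∧
    a * b * c + a * b * d + a * c * d + b * c * d = e₃ ∧ a * b * c * d = e₄ := by
  have hd : (X ^ 4 - C e₁ * X ^ 3 + C e₂ * X ^ 2 - C e₃ * X + C e₄ : ℂ[X]).degree = 4 := by
    compute_degree!
  obtain ⟨a, ha⟩ := IsAlgClosed.exists_root _ (by rw [hd]; norm_num :
    (X ^ 4 - C e₁ * X ^ 3 + C e₂ * X ^ 2 - C e₃ * X + C e₄ : ℂ[X]).degree ≠ 0)
  simp only [IsRoot.def, eval_add, eval_sub, eval_mul, eval_pow, eval_X, eval_C] at ha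
  obtain ⟨b, c, d, h1, h2, h3⟩ := exists_roots_three (e₁ - a) (e₂ - a * (e₁ - a))
    (e₃ - a * (e₂ - a * (e₁ - a)))
  exact ⟨a, b, c, d, by linear_combination h1, by linear_combination a * h1 + h2,
    by linear_combination a * h2 + h3, by linear_combination a * h3 - ha⟩

theorem poch_succ (x : ℂ) (n : ℕ) : poch x (n + 1) = poch x n * (x + n) :=
  Finset.prod_range_succ _ _

theorem poch_succ' (x : ℂ) (n : ℕ) : poch x (n + 1) = x * poch (x + 1) n := by
  rw [poch, poch, Finset.prod_range_succ', mul_comm]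
  congr 1
  · simp
  · exact Finset.prod_congr rfl fun i _ => by push_cast; ring

@[simp] theorem poch_zero (x : ℂ) : poch x 0 = 1 := rfl

theorem poch_shift (x : ℂ) {n k : ℕ} (h : k < n) :
    poch (x + k) (n - k) = (x + k) * poch (x + (k + 1 : ℕ)) (n - (k + 1)) := by
  obtain ⟨m, rfl⟩ := Nat.exists_eq_add_of_lt h
  rw [show k + m + 1 - k = m + 1 by omega, show k + m + 1 - (k + 1) = m by omega, poch_succ']
  push_cast; ring_nf

theorem poch_eq_zero {x : ℂ} {k n : ℕ} (hx : x = -(k : ℂ)) (h : k < n) : poch x n = 0 :=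
  Finset.prod_eq_zero (Finset.mem_range.2 h) (by rw [hx]; ring)

theorem poch_ne_zero {x : ℂ} {n : ℕ} (h : ∀ j < n, x + j ≠ 0) : poch x n ≠ 0 :=
  Finset.prod_ne_zero_iff.2 fun j hj => h j (Finset.mem_range.1 hj)

/-! ### The Wilson basis and the action of D, S and L on it -/

/-- The product `∏_{j<k} (y + (a + j)²)` at `y = κ z + μ`. -/
noncomputable def wBasis (κ μ a : ℂ) (k : ℕ) : ℂ[X] :=
  ∏ j ∈ Finset.range k, (C κ * X + C μ + C ((a + j) ^ 2))

section Basis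
variable (κ μ a : ℂ)

theorem wBasis_succ (k : ℕ) :
    wBasis κ μ a (k + 1) = wBasis κ μ a k * (C κ * X + C μ + C ((a + k) ^ 2)) :=
  Finset.prod_range_succ _ _

theorem wBasis_succ' (k : ℕ) :
    wBasis κ μ a (k + 1) = wBasis κ μ (a + 1) k * (C κ * X + C μ + C (a ^ 2)) := by
  rw [wBasis, wBasis, Finset.prod_range_succ']
  congr 1
  · exact Finset.prod_congr rfl fun i _ => by push_cast; ring_nf
  · simp

@[simp] theorem wBasis_zero : wBasis κ μ a 0 = 1 := rfl

theorem wBasis_eq_comp (k : ℕ) :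
    (∏ j ∈ Finset.range k, (X + C ((a + j) ^ 2)) : ℂ[X]).comp (C κ * X + C μ) =
      wBasis κ μ a k := by
  rw [prod_comp]; simp [wBasis]

theorem wBasis_degree (k : ℕ) : (wBasis κ μ a k).degree < ((k + 1 : ℕ) : WithBot ℕ) ∧
    (wBasis κ μ a k).coeff k = κ ^ k := by
  induction k with
  | zero => simp [degree_one]
  | succ k ih =>
    have e : wBasis κ μ a (k + 1) = C κ * (X * wBasis κ μ a k) +
      C (μ + (a + k) ^ 2) * wBasis κ μ a k := by rw [wBasis_succ, C_add]; ring
    obtain ⟨h1, h2⟩ := ih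
    rw [e]
    rw [degree_lt_iff_coeff_zero] at *
    refine ⟨fun m hm => ?_, ?_⟩
    · obtain ⟨m, rfl⟩ : ∃ j, m = j + 1 := ⟨m - 1, by omega⟩
      rw [coeff_add, coeff_C_mul, coeff_C_mul, coeff_X_mul, h1 m (by omega), h1 (m + 1) (by omega)]
      ring
    · rw [coeff_add, coeff_C_mul, coeff_C_mul, coeff_X_mul, h2, h1 (k + 1) le_rfl]; ring

theorem wBasis_eval {z : ℂ} (hz : κ * z + μ = -a ^ 2) (k : ℕ) :
    (wBasis κ μ a (k + 1)).eval z = 0 := by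
  rw [wBasis_succ']
  simp only [eval_mul, eval_add, eval_C, eval_X, hz]
  ring

variable {κ μ} {β c5 : ℂ} (hl : (β, c5) ≠ (0, 0)) (hκ : 4 * β * κ = -1)
  (hμ : μ = -(κ ^ 2 * (c5 ^ 2 / 4)))
include hl hκ hμ

/-- Under these choices of κ and μ, y = -t² with t = s + 𝔠₅/(8β), so the basis element is (a-t)_k
(a+t)_k. Its values at t ± 1/2 share the factor of the same kind with a + 1/2 and one index less. -/
theorem dX_sX_wBasis (k : ℕ) :
    dX β c5 (wBasis κ μ a (k + 1)) = C (κ * (k + 1)) * wBasis κ μ (a + 1 / 2) k ∧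
    sX β c5 (wBasis κ μ a (k + 1)) = wBasis κ μ (a + 1 / 2) k *
      (C κ * X + C μ + C ((a - 1 / 2) * (a + k + 1 / 2))) := by
  have hβκ : β * κ = -(1 / 4) := by linear_combination hκ / 4
  have hD : ∀ t, dX β c5 (C κ * X + C μ + C t) = C κ := fun t => by
    rw [map_add, map_add, dX_C_mul, dX_X, dX_C, dX_C]; ring
  have hS : ∀ t, sX β c5 (C κ * X + C μ + C t) = C κ * X + C μ + C (t - 1 / 4) := fun t => by
    rw [map_add, map_add, sX_C_mul, sX_X, sX_C, sX_C, mul_add, ← C_mul, mul_comm κ β, hβκ,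
      sub_eq_add_neg, C_add]; ring
  have hU : C (κ ^ 2) * (C (4 * β) * X + C (c5 ^ 2 / 4)) = -(C κ * X + C μ : ℂ[X]) := by
    rw [hμ, mul_add, ← mul_assoc, ← C_mul, ← C_mul,
      show κ ^ 2 * (4 * β) = -κ by linear_combination κ * hκ]
    simp only [C_neg]; ring
  induction k with
  | zero =>
    rw [wBasis_succ, wBasis_zero, wBasis_zero, one_mul, hD, hS]
    constructor
    · simp
    · push_cast
      rw [one_mul]; congr 2; ring
  | succ k ih =>
    rw [wBasis_succ κ μ a (k + 1), dX_mul hl, sX_mul hl, hD, hS, ih.1, ih.2,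
      wBasis_succ κ μ (a + 1 / 2) k]
    have e1 : (C (κ * (k + 1)) : ℂ[X]) * C κ = C (κ ^ 2) * C (k + 1 : ℂ) := by
      rw [← C_mul, ← C_mul]; congr 1; ring
    generalize wBasis κ μ (a + 1 / 2) k = w
    push_cast
    constructor
    · rw [show (a + (k + 1)) ^ 2 - 1 / 4 = (a + 1 / 2 + k) * (a + k + 3 / 2) by ring]
      have h2 : (2 : ℂ) * (1 / 2) = 1 := by norm_num
      have : C (κ * (↑k + 1)) * C ((a + 1 / 2 + ↑k) * (a + ↑k + 3 / 2)) +
        C κ * C ((a - 1 / 2) * (a + ↑k + 1 / 2)) =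
          C (κ * (↑k + 1 + 1)) * C ((a + 1 / 2 + ↑k) ^ 2) := by
        rw [← C_mul, ← C_mul, ← C_mul, ← C_add]; congr 1; ring
      have h3 : (C (κ * (↑k + 1 + 1)) : ℂ[X]) = C (κ * (k + 1)) + C κ := by
        rw [← C_add]; congr 1; ring
      linear_combination w * this - w * (C κ * X + C μ) * h3
    · have h4 : C ((a - 1 / 2) * (a + ↑k + 1 / 2)) * C ((a + (↑k + 1)) ^ 2 - 1 / 4) =
          C ((a + 1 / 2 + k) ^ 2) * C ((a - 1 / 2) * (a + (k + 1) + 1 / 2)) := by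
        rw [← C_mul, ← C_mul]; congr 1; ring
      have h5 : C ((a - 1 / 2) * (a + ↑k + 1 / 2)) + C ((a + (↑k + 1)) ^ 2 - 1 / 4) -
          C (k + 1 : ℂ) =
          C ((a + 1 / 2 + k) ^ 2) + C ((a - 1 / 2) * (a + (k + 1) + 1 / 2)) := by
        rw [← C_add, ← C_add, ← C_sub]; congr 1; ring
      linear_combination w * h4 + w * (C κ * X + C μ) * h5 +
        (C (4 * β) * X + C (c5 ^ 2 / 4)) * w * e1 + C (k + 1 : ℂ) * w * hU

variable {𝔞 p r q : ℂ}

/-- In terms of y the bracket contains κ²φ and κψ. At y = -a² it equals (k+1)(κ²φ + aκψ), so it is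
divisible by y + a² exactly when a is a root of the associated quartic; this makes L bidiagonal. -/
theorem opL_wBasis_add_two (k : ℕ) :
    opL β c5 (C 𝔞 * X ^ 2 + C p * X + C r) (X + C q) (wBasis κ μ a (k + 2)) =
      C ((k + 2 : ℕ) : ℂ) * wBasis κ μ (a + 1) k *
        (C (k + 1 : ℂ) * (C 𝔞 * (C κ * X + C μ) ^ 2 + C (p * κ - 2 * 𝔞 * μ) * (C κ * X + C μ) +
          C (𝔞 * μ ^ 2 - p * κ * μ + r * κ ^ 2)) +
        (C κ * X + C μ + C (κ * q - μ)) * (C κ * X + C μ + C (a * (a + k + 1)))) := by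
  have h1 := (dX_sX_wBasis a hl hκ hμ (k + 1)).1
  have h2 := (dX_sX_wBasis (a + 1 / 2) hl hκ hμ k)
  rw [opL_apply, h1, dX_C_mul, sX_C_mul, h2.1, h2.2,
    show a + 1 / 2 + 1 / 2 = a + 1 by ring,
    show (a + 1 / 2 - 1 / 2) * (a + 1 / 2 + k + 1 / 2) = a * (a + k + 1) by ring]
  generalize C (a * (a + k + 1)) = t
  push_cast
  simp only [C_mul, C_add, C_sub, C_ofNat, C_1, C_pow]
  ring

theorem opL_wBasis_one :
    opL β c5 (C 𝔞 * X ^ 2 + C p * X + C r) (X + C q) (wBasis κ μ a 1) =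
      C κ * X + C μ + C (κ * q - μ) := by
  have h1 := (dX_sX_wBasis a hl hκ hμ 0).1
  simp only [wBasis_zero, Nat.cast_zero, zero_add, mul_one] at h1
  rw [opL_apply, h1, dX_C, sX_C]
  simp only [C_mul, C_sub]; simp; ring

end Basis

/-- The parameters are the roots of the quartic `φ(-s²) + s ψ(-s²)` in the variable
`y = κ z + μ`, where `φ = 𝔞 z² + p z + r` and `ψ = z + q`. -/
def WilsonRoots (𝔞 p r q κ μ a b c d : ℂ) : Prop :=
  𝔞 * (a + b + c + d) = 1 ∧
  𝔞 * (a * b + a * c + a * d + b * c + b * d + c * d) = -(p * κ - 2 * 𝔞 * μ) ∧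
  𝔞 * (a * b * c + a * b * d + a * c * d + b * c * d) = -(κ * q - μ) ∧
  𝔞 * (a * b * c * d) = 𝔞 * μ ^ 2 - p * κ * μ + r * κ ^ 2

/-- The parameters are the roots of the cubic `-φ(-s²) - s ψ(-s²)` in the variable
`y = κ z + μ`, where `φ = p z + r` and `ψ = z + q`. -/
def HahnRoots (p r q κ μ a b c : ℂ) : Prop :=
  a + b + c = -(p * κ) ∧ a * b + a * c + b * c = -(κ * q - μ) ∧
  a * b * c = -(p * κ * μ) + r * κ ^ 2

theorem exists_wilsonRoots {𝔞 : ℂ} (h : 𝔞 ≠ 0) (p r q κ μ : ℂ) :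
    ∃ a b c d, WilsonRoots 𝔞 p r q κ μ a b c d := by
  obtain ⟨a, b, c, d, h1, h2, h3, h4⟩ := exists_roots_four (1 / 𝔞) (-(p * κ - 2 * 𝔞 * μ) / 𝔞)
    (-(κ * q - μ) / 𝔞) ((𝔞 * μ ^ 2 - p * κ * μ + r * κ ^ 2) / 𝔞)
  refine ⟨a, b, c, d, ?_, ?_, ?_, ?_⟩
  · rw [h1]; field_simp
  · rw [h2]; field_simp
  · rw [h3]; field_simp
  · rw [h4]; field_simp

theorem exists_hahnRoots (p r q κ μ : ℂ) : ∃ a b c, HahnRoots p r q κ μ a b c :=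
  exists_roots_three _ _ _

section Eigen
variable {κ μ β c5 : ℂ} (hl : (β, c5) ≠ (0, 0)) (hκ : 4 * β * κ = -1)
  (hμ : μ = -(κ ^ 2 * (c5 ^ 2 / 4))) {𝔞 p r q a b c d : ℂ}
include hl hκ hμ

theorem opL_wBasis_wilson (h : WilsonRoots 𝔞 p r q κ μ a b c d) (k : ℕ) :
    opL β c5 (C 𝔞 * X ^ 2 + C p * X + C r) (X + C q) (wBasis κ μ a (k + 1)) =
      C (eigval 𝔞 (k + 1)) * wBasis κ μ a (k + 1) -
      C ((k + 1 : ℂ) * (𝔞 * ((a + b + k) * (a + c + k) * (a + d + k)))) * wBasis κ μ a k := by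
  obtain ⟨h1, h2, h3, h4⟩ := h
  cases k with
  | zero =>
    rw [zero_add, opL_wBasis_one a hl hκ hμ, wBasis_zero, ← zero_add 1, wBasis_succ, wBasis_zero]
    have e : κ * q - μ = a ^ 2 - 𝔞 * ((a + b) * (a + c) * (a + d)) := by
      linear_combination h3 + a ^ 2 * h1
    rw [e]
    simp only [eigval]
    push_cast
    simp only [C_sub, add_zero, zero_add, sub_self, zero_mul, C_1, one_mul, mul_one]
    ring
  | succ k =>
    rw [opL_wBasis_add_two a hl hκ hμ, wBasis_succ' κ μ a (k + 1), wBasis_succ,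
      wBasis_succ' κ μ a k, ← h4, (by linear_combination h2 : p * κ - 2 * 𝔞 * μ =
        -(𝔞 * (a * b + a * c + a * d + b * c + b * d + c * d))),
      (by linear_combination h3 : κ * q - μ =
        -(𝔞 * (a * b * c + a * b * d + a * c * d + b * c * d)))]
    have h5 : C 𝔞 * (C a + C b + C c + C d) = (1 : ℂ[X]) := by
      rw [← C_add, ← C_add, ← C_add, ← C_mul, h1, C_1]
    generalize wBasis κ μ (a + 1) k = w
    generalize (C κ * X + C μ : ℂ[X]) = Y
    simp only [eigval]
    push_cast
    simp only [C_mul, C_add, C_sub, C_ofNat, C_1, C_pow, C_neg]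
    linear_combination (C (k : ℂ) + 2) * w * ((Y + C a ^ 2) * (Y + (C a + 1 + C (k : ℂ)) ^ 2) -
      Y * (Y + C a * (C a + C (k : ℂ) + 1))) * h5

/-- The degenerate case 𝔞 = 0, in which the quartic drops to a cubic and one factor a + d + k
disappears. -/
theorem opL_wBasis_hahn (h : HahnRoots p r q κ μ a b c) (k : ℕ) :
    opL β c5 (C 0 * X ^ 2 + C p * X + C r) (X + C q) (wBasis κ μ a (k + 1)) =
      C (eigval 0 (k + 1)) * wBasis κ μ a (k + 1) -
      C ((k + 1 : ℂ) * ((a + b + k) * (a + c + k))) * wBasis κ μ a k := by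
  obtain ⟨h1, h2, h3⟩ := h
  cases k with
  | zero =>
    rw [zero_add, opL_wBasis_one a hl hκ hμ, wBasis_zero, ← zero_add 1, wBasis_succ, wBasis_zero]
    have e : κ * q - μ = a ^ 2 - (a + b) * (a + c) := by
      linear_combination h2
    rw [e]
    simp only [eigval]
    push_cast
    simp only [C_sub, add_zero, zero_add, sub_self, zero_mul, C_1, one_mul, mul_one]
    ring
  | succ k =>
    rw [opL_wBasis_add_two a hl hκ hμ, wBasis_succ' κ μ a (k + 1), wBasis_succ,
      wBasis_succ' κ μ a k, (by linear_combination -h3 :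
        0 * μ ^ 2 - p * κ * μ + r * κ ^ 2 = a * b * c),
      (by linear_combination h1 : p * κ - 2 * 0 * μ = -(a + b + c)),
      (by linear_combination h2 : κ * q - μ = -(a * b + a * c + b * c))]
    generalize wBasis κ μ (a + 1) k = w
    generalize (C κ * X + C μ : ℂ[X]) = Y
    simp only [eigval]
    push_cast
    simp only [C_mul, C_add, C_sub, C_ofNat, C_1, C_0, C_pow, C_neg]
    ring

omit hl hκ hμ in
/-- An eigenvector of an operator which is bidiagonal on `wBasis`. -/
theorem opL_sum_wBasis {φ ψ : ℂ[X]} {ev ν w : ℕ → ℂ} {n : ℕ}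
    (h0 : ev 0 = 0)
    (hk : ∀ k, opL β c5 φ ψ (wBasis κ μ a (k + 1)) =
      C (ev (k + 1)) * wBasis κ μ a (k + 1) - C ((k + 1 : ℂ) * ν k) * wBasis κ μ a k)
    (hw : ∀ k < n, (ev k - ev n) * w k = (k + 1 : ℂ) * ν k * w (k + 1)) :
    opL β c5 φ ψ (∑ k ∈ Finset.range (n + 1), C (w k) * wBasis κ μ a k) =
      C (ev n) * ∑ k ∈ Finset.range (n + 1), C (w k) * wBasis κ μ a k := by
  have hz : opL β c5 φ ψ (wBasis κ μ a 0) = 0 := by rw [opL_apply, wBasis_zero]; simp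
  rw [map_sum, Finset.sum_range_succ', opL_C_mul, hz, mul_zero, add_zero]
  have e1 : ∀ k, opL β c5 φ ψ (C (w (k + 1)) * wBasis κ μ a (k + 1)) =
      C (ev (k + 1) * w (k + 1)) * wBasis κ μ a (k + 1) -
        C ((k + 1 : ℂ) * ν k * w (k + 1)) * wBasis κ μ a k := fun k => by
    rw [opL_C_mul, hk]; simp only [C_mul]; ring
  have e2 : ∑ k ∈ Finset.range n, C ((k + 1 : ℂ) * ν k * w (k + 1)) * wBasis κ μ a k =
      ∑ k ∈ Finset.range n, C ((ev k - ev n) * w k) * wBasis κ μ a k :=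
    Finset.sum_congr rfl fun k hk' => by rw [hw k (Finset.mem_range.1 hk')]
  have e3 : ∑ k ∈ Finset.range n, C (ev (k + 1) * w (k + 1)) * wBasis κ μ a (k + 1) =
      ∑ k ∈ Finset.range (n + 1), C (ev k * w k) * wBasis κ μ a k := by
    rw [Finset.sum_range_succ' _ n, h0]; simp
  rw [Finset.sum_congr rfl fun k _ => e1 k, Finset.sum_sub_distrib, e2, e3, Finset.sum_range_succ,
    Finset.sum_range_succ (fun k => C (w k) * wBasis κ μ a k), add_sub_right_comm,
    ← Finset.sum_sub_distrib, mul_add, Finset.mul_sum]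
  congr 1
  · exact Finset.sum_congr rfl fun k _ => by simp only [C_mul, C_sub]; ring
  · simp only [C_mul]; ring

end Eigen

/-! ### Wilson and continuous dual Hahn polynomials as eigenvectors -/

/-- The coefficients of the Wilson polynomial in the basis `wBasis`. -/
noncomputable def wilsonCoeff (a b c d : ℂ) (n k : ℕ) : ℂ :=
  poch (-(n : ℂ)) k * poch (n + a + b + c + d - 1) k / (k.factorial : ℂ) *
        (poch (a + b + k) (n - k) * poch (a + c + k) (n - k) * poch (a + d + k) (n - k))

/-- The coefficients of the continuous dual Hahn polynomial in the basis `wBasis`. -/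
noncomputable def hahnCoeff (a b c : ℂ) (n k : ℕ) : ℂ :=
  poch (-(n : ℂ)) k / (k.factorial : ℂ) * (poch (a + b + k) (n - k) * poch (a + c + k) (n - k))

theorem wilson_comp (κ μ a b c d : ℂ) (n : ℕ) : (wilson a b c d n).comp (C κ * X + C μ) =
    ∑ k ∈ Finset.range (n + 1), C (wilsonCoeff a b c d n k) * wBasis κ μ a k := by
  rw [wilson, Polynomial.sum_comp]
  exact Finset.sum_congr rfl fun k _ => by rw [mul_comp, C_comp, wBasis_eq_comp, wilsonCoeff]

theorem contDualHahn_comp (κ μ a b c : ℂ) (n : ℕ) :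
    (contDualHahn a b c n).comp (C κ * X + C μ) =
    ∑ k ∈ Finset.range (n + 1), C (hahnCoeff a b c n k) * wBasis κ μ a k := by
  rw [contDualHahn, Polynomial.sum_comp]
  exact Finset.sum_congr rfl fun k _ => by rw [mul_comp, C_comp, wBasis_eq_comp, hahnCoeff]

theorem sum_wBasis_degree (κ μ a : ℂ) (w : ℕ → ℂ) (n : ℕ) :
    (∑ k ∈ Finset.range (n + 1), C (w k) * wBasis κ μ a k).degree < ((n + 1 : ℕ) : WithBot ℕ) ∧
    (∑ k ∈ Finset.range (n + 1), C (w k) * wBasis κ μ a k).coeff n = w n * κ ^ n := by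
  have h := fun k => wBasis_degree κ μ a k
  constructor
  · rw [degree_lt_iff_coeff_zero]
    intro m hm
    rw [finsetSum_coeff]
    refine Finset.sum_eq_zero fun k hk => ?_
    have := Finset.mem_range.1 hk
    rw [coeff_C_mul, (degree_lt_iff_coeff_zero _ _).1 (h k).1 m (by omega), mul_zero]
  · rw [finsetSum_coeff, Finset.sum_range_succ, Finset.sum_eq_zero, zero_add, coeff_C_mul, (h n).2]
    intro k hk
    have := Finset.mem_range.1 hk
    rw [coeff_C_mul, (degree_lt_iff_coeff_zero _ _).1 (h k).1 n (by omega), mul_zero]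

theorem sum_wBasis_eval {κ μ a z : ℂ} (hz : κ * z + μ = -a ^ 2) (w : ℕ → ℂ) (n : ℕ) :
    (∑ k ∈ Finset.range (n + 1), C (w k) * wBasis κ μ a k).eval z = w 0 := by
  rw [Finset.sum_range_succ', eval_add, eval_finsetSum, Finset.sum_eq_zero]
  · simp
  · intro k _
    rw [eval_mul, wBasis_eval κ μ a hz, mul_zero]

theorem poch_neg_self_ne_zero (n : ℕ) : poch (-(n : ℂ)) n ≠ 0 :=
  poch_ne_zero fun j hj h => by
    have : (n : ℂ) = j := by linear_combination -h
    have : n = j := by exact_mod_cast this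
    omega

theorem wilsonCoeff_self_ne_zero {a b c d : ℂ} (h : ∀ m : ℕ, a + b + c + d ≠ -(m : ℂ)) (n : ℕ) :
    wilsonCoeff a b c d n n ≠ 0 := by
  rw [wilsonCoeff, Nat.sub_self]
  simp only [poch_zero, mul_one]
  refine div_ne_zero (mul_ne_zero (poch_neg_self_ne_zero n) (poch_ne_zero fun j hj h' => ?_))
    (by exact_mod_cast n.factorial_ne_zero)
  obtain ⟨n, rfl⟩ : ∃ m, n = m + 1 := ⟨n - 1, by omega⟩
  refine h (n + j) ?_
  push_cast at h' ⊢
  linear_combination h'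

theorem hahnCoeff_self_ne_zero (a b c : ℂ) (n : ℕ) : hahnCoeff a b c n n ≠ 0 := by
  rw [hahnCoeff, Nat.sub_self]
  simp only [poch_zero, mul_one]
  exact div_ne_zero (poch_neg_self_ne_zero n) (by exact_mod_cast n.factorial_ne_zero)

/-- Because 𝔞 is the inverse of the parameter sum, λ_k - λ_n = 𝔞 (k-n)(n+k+a+b+c+d-1), which is the
ratio of consecutive hypergeometric terms. -/
theorem wilsonCoeff_succ {𝔞 a b c d : ℂ} (h : 𝔞 * (a + b + c + d) = 1) {n k : ℕ} (hk : k < n) :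
    (eigval 𝔞 k - eigval 𝔞 n) * wilsonCoeff a b c d n k =
      (k + 1 : ℂ) * (𝔞 * ((a + b + k) * (a + c + k) * (a + d + k))) *
        wilsonCoeff a b c d n (k + 1) := by
  rw [wilsonCoeff, wilsonCoeff, poch_shift _ hk, poch_shift _ hk, poch_shift _ hk, poch_succ,
    poch_succ, Nat.factorial_succ]
  have h1 : ((k : ℂ) + 1) ≠ 0 := by exact_mod_cast k.succ_ne_zero
  have h2 : ((k.factorial : ℕ) : ℂ) ≠ 0 := by exact_mod_cast k.factorial_ne_zero
  have h3 : eigval 𝔞 k - eigval 𝔞 n = 𝔞 * ((k - n) * (n + a + b + c + d - 1 + k)) := by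
    simp only [eigval]; linear_combination (n - k : ℂ) * h
  rw [h3]
  push_cast
  field_simp
  ring

theorem hahnCoeff_succ {a b c : ℂ} {n k : ℕ} (hk : k < n) :
    (eigval 0 k - eigval 0 n) * hahnCoeff a b c n k =
      (k + 1 : ℂ) * ((a + b + k) * (a + c + k)) * hahnCoeff a b c n (k + 1) := by
  rw [hahnCoeff, hahnCoeff, poch_shift _ hk, poch_shift _ hk, poch_succ, Nat.factorial_succ]
  have h1 : ((k : ℂ) + 1) ≠ 0 := by exact_mod_cast k.succ_ne_zero
  have h2 : ((k.factorial : ℕ) : ℂ) ≠ 0 := by exact_mod_cast k.factorial_ne_zero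
  simp only [eigval]
  push_cast
  field_simp
  ring

/-- Since no C_n vanishes, the recurrence carries a common zero down to `P 0 = 1`. -/
theorem IsMonicOPS.no_common_zero {u : ℂ[X] →ₗ[ℂ] ℂ} {P : ℕ → ℂ[X]} (hP : IsMonicOPS u P) (z : ℂ)
    (n : ℕ) (h0 : (P n).eval z = 0) (h1 : (P (n + 1)).eval z = 0) : False := by
  induction n with
  | zero => rw [hP.zero_eq] at h0; simp at h0
  | succ n ih =>
    refine ih ?_ h0
    have h2 := congrArg (eval z) (hP.recurrence (n + 1))
    rw [h1, eval_sub, eval_mul, h0, eval_mul, eval_C, mul_zero, zero_sub, eq_comm, neg_eq_zero,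
      mul_eq_zero] at h2
    exact h2.resolve_left (hP.recC_ne_zero _)

/-- At y = -a² only the term k = 0 of the expansion survives, and it contains (x)_n. If x = -k, all
`P n` with n > k would vanish at that point. -/
theorem IsMonicOPS.ne_neg_nat {u : ℂ[X] →ₗ[ℂ] ℂ} {P : ℕ → ℂ[X]} (hP : IsMonicOPS u P)
    {κ μ a x : ℂ} (hκ : κ ≠ 0) {s y : ℕ → ℂ} {w : ℕ → ℕ → ℂ}
    (h : ∀ n, P n = C (s n) * ∑ k ∈ Finset.range (n + 1), C (w n k) * wBasis κ μ a k)
    (hw : ∀ n, w n 0 = poch x n * y n) (k : ℕ) : x ≠ -(k : ℂ) := by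
  intro hx
  have hz : κ * ((-a ^ 2 - μ) / κ) + μ = -a ^ 2 := by field_simp; ring
  have h0 : ∀ n, k < n → (P n).eval ((-a ^ 2 - μ) / κ) = 0 := fun n hn => by
    rw [h, eval_mul, sum_wBasis_eval hz, hw, poch_eq_zero hx hn]; ring
  exact hP.no_common_zero _ (k + 1) (h0 _ (by omega)) (h0 _ (by omega))

/-- The monic multiple of a combination of the basis `wBasis`. -/
noncomputable def monicSum (κ μ a : ℂ) (w : ℕ → ℂ) (n : ℕ) : ℂ[X] :=
  C ((w n * κ ^ n)⁻¹) * ∑ k ∈ Finset.range (n + 1), C (w k) * wBasis κ μ a k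

theorem monicSum_degree {κ μ a : ℂ} (hκ : κ ≠ 0) {w : ℕ → ℂ} {n : ℕ} (hw : w n ≠ 0) :
    (monicSum κ μ a w n).degree < ((n + 1 : ℕ) : WithBot ℕ) ∧ (monicSum κ μ a w n).coeff n = 1 := by
  obtain ⟨h1, h2⟩ := sum_wBasis_degree κ μ a w n
  rw [degree_lt_iff_coeff_zero] at *
  refine ⟨fun m hm => ?_, ?_⟩
  · rw [monicSum, coeff_C_mul, h1 m hm, mul_zero]
  · rw [monicSum, coeff_C_mul, h2]
    exact inv_mul_cancel₀ (mul_ne_zero hw (pow_ne_zero _ hκ))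

theorem monic_of_degree_lt {f : ℂ[X]} {n : ℕ} (h : f.degree < ((n + 1 : ℕ) : WithBot ℕ))
    (h1 : f.coeff n = 1) : f.Monic :=
  monic_of_degree_le n (Order.le_of_lt_succ h) h1

theorem eq_of_opL_eigen (β c5 : ℂ) {𝔞 p r q : ℂ} (hd : ∀ k : ℕ, 1 + (k : ℂ) * 𝔞 ≠ 0) {n : ℕ}
    {f g : ℂ[X]} (hf : f.degree < ((n + 1 : ℕ) : WithBot ℕ)) (hf1 : f.coeff n = 1)
    (hg : g.degree < ((n + 1 : ℕ) : WithBot ℕ)) (hg1 : g.coeff n = 1)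
    (ef : opL β c5 (C 𝔞 * X ^ 2 + C p * X + C r) (X + C q) f = C (eigval 𝔞 n) * f)
    (eg : opL β c5 (C 𝔞 * X ^ 2 + C p * X + C r) (X + C q) g = C (eigval 𝔞 n) * g) : f = g := by
  refine sub_eq_zero.1 (opL_unique β c5 𝔞 p r q hd (n := n) ?_ ?_)
  · rw [degree_lt_iff_coeff_zero] at *
    intro m hm
    rw [coeff_sub]
    rcases hm.eq_or_lt with rfl | h
    · rw [hf1, hg1, sub_self]
    · rw [hf m h, hg m h, sub_self]
  · rw [map_sub, ef, eg, mul_sub]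

section
variable {κ μ β c5 : ℂ} (hl : (β, c5) ≠ (0, 0)) (hκ : 4 * β * κ = -1)
  (hμ : μ = -(κ ^ 2 * (c5 ^ 2 / 4))) {𝔞 p r q a b c d : ℂ}
include hl hκ hμ

theorem opL_wilson (h : WilsonRoots 𝔞 p r q κ μ a b c d) (n : ℕ) :
    opL β c5 (C 𝔞 * X ^ 2 + C p * X + C r) (X + C q)
      (monicSum κ μ a (wilsonCoeff a b c d n) n) =
      C (eigval 𝔞 n) * monicSum κ μ a (wilsonCoeff a b c d n) n := by
  rw [monicSum, opL_C_mul, opL_sum_wBasis (by simp [eigval]) (opL_wBasis_wilson hl hκ hμ h)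
    fun k hk => wilsonCoeff_succ h.1 hk]
  ring

theorem opL_hahn (h : HahnRoots p r q κ μ a b c) (n : ℕ) :
    opL β c5 (C 0 * X ^ 2 + C p * X + C r) (X + C q)
      (monicSum κ μ a (hahnCoeff a b c n) n) =
      C (eigval 0 n) * monicSum κ μ a (hahnCoeff a b c n) n := by
  rw [monicSum, opL_C_mul, opL_sum_wBasis (by simp [eigval]) (opL_wBasis_hahn hl hκ hμ h)
    fun k hk => hahnCoeff_succ hk]
  ring

end

theorem WilsonRoots.sum_ne {𝔞 p r q κ μ a b c d : ℂ} (h : WilsonRoots 𝔞 p r q κ μ a b c d)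
    (hd : ∀ k : ℕ, 1 + (k : ℂ) * 𝔞 ≠ 0) (k : ℕ) : a + b + c + d ≠ -(k : ℂ) := fun h' =>
  hd k (by have := h.1; rw [h'] at this; linear_combination -this)

/-- The root conditions are symmetric, so any parameter may take the distinguished first place in
the expansion. This reaches the pair sums not involving a. -/
theorem WilsonRoots.swap {𝔞 p r q κ μ a b c d : ℂ} (h : WilsonRoots 𝔞 p r q κ μ a b c d) :
    WilsonRoots 𝔞 p r q κ μ b a c d :=
  ⟨by linear_combination h.1, by linear_combination h.2.1, by linear_combination h.2.2.1,
    by linear_combination h.2.2.2⟩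

theorem WilsonRoots.rotate {𝔞 p r q κ μ a b c d : ℂ} (h : WilsonRoots 𝔞 p r q κ μ a b c d) :
    WilsonRoots 𝔞 p r q κ μ c a b d :=
  ⟨by linear_combination h.1, by linear_combination h.2.1, by linear_combination h.2.2.1,
    by linear_combination h.2.2.2⟩

theorem HahnRoots.swap {p r q κ μ a b c : ℂ} (h : HahnRoots p r q κ μ a b c) :
    HahnRoots p r q κ μ b a c :=
  ⟨by linear_combination h.1, by linear_combination h.2.1, by linear_combination h.2.2⟩

theorem isWilson_monicSum {κ μ a b c d : ℂ} (hκ : κ ≠ 0) (h : WilsonParams a b c d) :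
    IsWilson κ μ fun n => monicSum κ μ a (wilsonCoeff a b c d n) n :=
  ⟨a, b, c, d, h, fun n => ⟨_, inv_ne_zero (mul_ne_zero
    (wilsonCoeff_self_ne_zero (fun m => (h m).2.2.2.2.2.2) n) (pow_ne_zero _ hκ)),
    by rw [wilson_comp]; rfl⟩⟩

theorem isContDualHahn_monicSum {κ μ a b c : ℂ} (hκ : κ ≠ 0) (h : ContDualHahnParams a b c) :
    IsContDualHahn κ μ fun n => monicSum κ μ a (hahnCoeff a b c n) n :=
  ⟨a, b, c, h, fun n => ⟨_, inv_ne_zero (mul_ne_zero (hahnCoeff_self_ne_zero a b c n)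
    (pow_ne_zero _ hκ)), by rw [contDualHahn_comp]; rfl⟩⟩

/-! ### Identification of the orthogonal sequence when β ≠ 0 -/

section Classification
variable {β c5 : ℂ} (hβ : β ≠ 0) {u : ℂ[X] →ₗ[ℂ] ℂ} {P : ℕ → ℂ[X]}
  (hP : IsMonicOPS u P) {𝔞 p r q : ℂ} (hd : ∀ k : ℕ, 1 + (k : ℂ) * 𝔞 ≠ 0)
  (he : ∀ n, opL β c5 (C 𝔞 * X ^ 2 + C p * X + C r) (X + C q) (P n) = C (eigval 𝔞 n) * P n)
  {κ μ : ℂ} (hκ : 4 * β * κ = -1) (hμ : μ = -(κ ^ 2 * (c5 ^ 2 / 4)))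
include hβ hP hd he hκ hμ

theorem isWilson_of_eigen (h𝔞 : 𝔞 ≠ 0) : IsWilson κ μ P := by
  have hl : (β, c5) ≠ (0, 0) := fun h => hβ (congrArg Prod.fst h)
  have hκ0 : κ ≠ 0 := by rintro rfl; simp at hκ
  have key : ∀ a b c d, WilsonRoots 𝔞 p r q κ μ a b c d → ∀ n,
      P n = monicSum κ μ a (wilsonCoeff a b c d n) n := fun a b c d h n => by
    have h1 := monicSum_degree (μ := μ) (a := a) hκ0
      (wilsonCoeff_self_ne_zero (h.sum_ne hd) n)
    exact eq_of_opL_eigen β c5 hd (hP.degree_lt n) (hP.coeff_self n) h1.1 h1.2 (he n)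
      (opL_wilson hl hκ hμ h n)
  -- The constant coefficient is (a+b)_n (a+c)_n (a+d)_n; one factor is singled out and `y` collects
  -- the others.
  have key2 : ∀ a b c d, WilsonRoots 𝔞 p r q κ μ a b c d → ∀ k : ℕ,
      a + b ≠ -(k : ℂ) ∧ a + c ≠ -(k : ℂ) ∧ a + d ≠ -(k : ℂ) := fun a b c d h k =>
    ⟨hP.ne_neg_nat hκ0 (key a b c d h) (y := fun n => poch (a + c) n * poch (a + d) n)
      (fun n => by simp [wilsonCoeff, mul_assoc]) k,
     hP.ne_neg_nat hκ0 (key a b c d h) (y := fun n => poch (a + b) n * poch (a + d) n)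
      (fun n => by simp [wilsonCoeff]; ring) k,
     hP.ne_neg_nat hκ0 (key a b c d h) (y := fun n => poch (a + b) n * poch (a + c) n)
      (fun n => by simp [wilsonCoeff]; ring) k⟩
  obtain ⟨a, b, c, d, h⟩ := exists_wilsonRoots h𝔞 p r q κ μ
  have hp : WilsonParams a b c d := fun k => by
    obtain ⟨h1, h2, h3⟩ := key2 _ _ _ _ h k
    obtain ⟨-, h4, h5⟩ := key2 _ _ _ _ h.swap k
    exact ⟨h1, h2, h3, h4, h5, (key2 _ _ _ _ h.rotate k).2.2, h.sum_ne hd k⟩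
  rw [funext (key a b c d h)]
  exact isWilson_monicSum hκ0 hp

omit hd in
theorem isContDualHahn_of_eigen (h𝔞 : 𝔞 = 0) : IsContDualHahn κ μ P := by
  subst h𝔞
  have hl : (β, c5) ≠ (0, 0) := fun h => hβ (congrArg Prod.fst h)
  have hκ0 : κ ≠ 0 := by rintro rfl; simp at hκ
  have key : ∀ a b c, HahnRoots p r q κ μ a b c → ∀ n,
      P n = monicSum κ μ a (hahnCoeff a b c n) n := fun a b c h n => by
    have h1 := monicSum_degree (μ := μ) (a := a) hκ0 (hahnCoeff_self_ne_zero a b c n)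
    exact eq_of_opL_eigen β c5 (by simp) (hP.degree_lt n) (hP.coeff_self n) h1.1 h1.2 (he n)
      (opL_hahn hl hκ hμ h n)
  have key2 : ∀ a b c, HahnRoots p r q κ μ a b c → ∀ k : ℕ,
      a + b ≠ -(k : ℂ) ∧ a + c ≠ -(k : ℂ) := fun a b c h k =>
    ⟨hP.ne_neg_nat hκ0 (key a b c h) (y := fun n => poch (a + c) n)
      (fun n => by simp [hahnCoeff]) k,
     hP.ne_neg_nat hκ0 (key a b c h) (y := fun n => poch (a + b) n)
      (fun n => by simp [hahnCoeff]; ring) k⟩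
  obtain ⟨a, b, c, h⟩ := exists_hahnRoots p r q κ μ
  have hp : ContDualHahnParams a b c := fun k =>
    ⟨(key2 _ _ _ h k).1, (key2 _ _ _ h k).2, (key2 _ _ _ h.swap k).2⟩
  rw [funext (key a b c h)]
  exact isContDualHahn_monicSum hκ0 hp

end Classification

/-! ### Continuity in the lattice parameter and in the Wilson parameters -/

/-- Continuity of all coefficients of a family of polynomials. -/
def CoeffContinuousAt (F : ℂ → ℂ[X]) (x : ℂ) : Prop := ∀ k, ContinuousAt (fun t => (F t).coeff k) x

theorem CoeffContinuousAt.const (f : ℂ[X]) (x : ℂ) : CoeffContinuousAt (fun _ => f) x :=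
  fun _ => continuousAt_const

theorem CoeffContinuousAt.scalar {g : ℂ → ℂ} {x : ℂ} (hg : ContinuousAt g x) :
    CoeffContinuousAt (fun t => C (g t)) x := fun k => by
  simp only [coeff_C]
  by_cases hk : k = 0
  · simpa [hk] using hg
  · simpa [hk] using continuousAt_const

theorem CoeffContinuousAt.add {F G : ℂ → ℂ[X]} {x : ℂ} (hF : CoeffContinuousAt F x)
    (hG : CoeffContinuousAt G x) : CoeffContinuousAt (fun t => F t + G t) x := fun k => by
  simp only [coeff_add]; exact (hF k).add (hG k)

theorem CoeffContinuousAt.mul {F G : ℂ → ℂ[X]} {x : ℂ} (hF : CoeffContinuousAt F x)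
    (hG : CoeffContinuousAt G x) : CoeffContinuousAt (fun t => F t * G t) x := fun k => by
  simp only [coeff_mul]
  exact tendsto_finsetSum _ fun i _ => (hF i.1).mul (hG i.2)

theorem CoeffContinuousAt.sum {ι : Type*} {F : ι → ℂ → ℂ[X]} {x : ℂ} (s : Finset ι)
    (hF : ∀ i ∈ s, CoeffContinuousAt (F i) x) :
    CoeffContinuousAt (fun t => ∑ i ∈ s, F i t) x := fun k => by
  simp only [finsetSum_coeff]
  exact tendsto_finsetSum _ fun i hi => hF i hi k

theorem CoeffContinuousAt.prod_range {F : ℕ → ℂ → ℂ[X]} {x : ℂ} (n : ℕ)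
    (hF : ∀ i, CoeffContinuousAt (F i) x) :
    CoeffContinuousAt (fun t => ∏ i ∈ Finset.range n, F i t) x := by
  induction n with
  | zero => simpa using CoeffContinuousAt.const 1 x
  | succ n ih => simpa only [Finset.prod_range_succ] using ih.mul (hF n)

theorem eq_sum_range_of_degree_lt {f : ℂ[X]} {n : ℕ} (h : f.degree < (n : WithBot ℕ)) :
    f = ∑ i ∈ Finset.range n, C (f.coeff i) * X ^ i := by
  ext k
  simp only [finsetSum_coeff, coeff_C_mul, coeff_X_pow]
  simp only [mul_ite, mul_one, mul_zero, Finset.sum_ite_eq, Finset.mem_range]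
  split_ifs with hk
  · rfl
  · exact (degree_lt_iff_coeff_zero _ _).1 h k (by omega)

section Lattice
variable (c5 : ℂ) (x : ℂ)

theorem coeffContinuousAt_DSmono (n : ℕ) :
    CoeffContinuousAt (fun β => (DSmono β c5 n).1) x ∧
    CoeffContinuousAt (fun β => (DSmono β c5 n).2) x := by
  have h1 : CoeffContinuousAt (fun β : ℂ => X + C β) x :=
    (CoeffContinuousAt.const X x).add (CoeffContinuousAt.scalar continuousAt_id)
  have h2 : CoeffContinuousAt (fun β : ℂ => C (4 * β) * X + C (c5 ^ 2 / 4)) x :=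
    ((CoeffContinuousAt.scalar (by fun_prop)).mul (CoeffContinuousAt.const X x)).add
      (CoeffContinuousAt.const _ x)
  induction n with
  | zero => exact ⟨CoeffContinuousAt.const _ x, CoeffContinuousAt.const _ x⟩
  | succ n ih => exact ⟨(h1.mul ih.1).add ih.2, (h2.mul ih.1).add (h1.mul ih.2)⟩

theorem CoeffContinuousAt.dX_sX {F : ℂ → ℂ[X]} {n : ℕ} (hd : ∀ t, (F t).degree < (n : WithBot ℕ))
    (hF : CoeffContinuousAt F x) : CoeffContinuousAt (fun β => dX β c5 (F β)) x ∧
      CoeffContinuousAt (fun β => sX β c5 (F β)) x := by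
  have e1 : (fun β => dX β c5 (F β)) = fun β =>
      ∑ i ∈ Finset.range n, C ((F β).coeff i) * (DSmono β c5 i).1 := by
    funext β
    conv_lhs => rw [eq_sum_range_of_degree_lt (hd β), map_sum]
    exact Finset.sum_congr rfl fun i _ => by rw [dX_C_mul, dX_X_pow]
  have e2 : (fun β => sX β c5 (F β)) = fun β =>
      ∑ i ∈ Finset.range n, C ((F β).coeff i) * (DSmono β c5 i).2 := by
    funext β
    conv_lhs => rw [eq_sum_range_of_degree_lt (hd β), map_sum]
    exact Finset.sum_congr rfl fun i _ => by rw [sX_C_mul, sX_X_pow]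
  rw [e1, e2]
  exact ⟨CoeffContinuousAt.sum _ fun i _ => (CoeffContinuousAt.scalar (hF i)).mul
      (coeffContinuousAt_DSmono c5 x i).1, CoeffContinuousAt.sum _ fun i _ =>
      (CoeffContinuousAt.scalar (hF i)).mul (coeffContinuousAt_DSmono c5 x i).2⟩

theorem coeffContinuousAt_opL_X_pow (φ ψ : ℂ[X]) (n : ℕ) :
    CoeffContinuousAt (fun β => opL β c5 φ ψ (X ^ n)) x := by
  have h := coeffContinuousAt_DSmono c5 x n
  have h1 := CoeffContinuousAt.dX_sX c5 x (fun β => (DSmono_degree β c5 n).1) h.1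
  have e : (fun β => opL β c5 φ ψ (X ^ n)) = fun β =>
      φ * dX β c5 (DSmono β c5 n).1 + ψ * sX β c5 (DSmono β c5 n).1 := by
    funext β; rw [opL_apply, dX_X_pow]
  rw [e]
  exact ((CoeffContinuousAt.const φ x).mul h1.1).add ((CoeffContinuousAt.const ψ x).mul h1.2)

end Lattice

/-- The lower coefficients of an eigenvector are determined by the higher ones. -/
theorem eigen_coeff (β c5 𝔞 p r q : ℂ) {n : ℕ} {f : ℂ[X]}
    (hf : f.degree < ((n + 1 : ℕ) : WithBot ℕ))
    (h : opL β c5 (C 𝔞 * X ^ 2 + C p * X + C r) (X + C q) f = C (eigval 𝔞 n) * f) {j : ℕ}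
    (hj : j < n) : (eigval 𝔞 n - eigval 𝔞 j) * f.coeff j =
      ∑ i ∈ (Finset.range (n + 1)).filter (j < ·), f.coeff i *
        (opL β c5 (C 𝔞 * X ^ 2 + C p * X + C r) (X + C q) (X ^ i)).coeff j := by
  have h1 := congrArg (fun g => g.coeff j) h
  have hX : ∀ i : ℕ, (X ^ i : ℂ[X]).degree < ((i + 1 : ℕ) : WithBot ℕ) := fun i => by
    rw [degree_X_pow]; exact_mod_cast Nat.lt_succ_self _
  simp only [coeff_C_mul] at h1
  conv_lhs at h1 => rw [eq_sum_range_of_degree_lt hf, map_sum, finsetSum_coeff]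
  rw [sub_mul, ← h1, ← Finset.sum_filter_add_sum_filter_not _ (j < ·)]
  have e1 : ∑ i ∈ (Finset.range (n + 1)).filter (fun i => ¬ j < i),
      (opL β c5 (C 𝔞 * X ^ 2 + C p * X + C r) (X + C q) (C (f.coeff i) * X ^ i)).coeff j =
      eigval 𝔞 j * f.coeff j := by
    rw [Finset.sum_eq_single_of_mem j (by simp; omega)]
    · rw [opL_C_mul, coeff_C_mul, (opL_degree β c5 𝔞 p r q (hX j)).2, coeff_X_pow_self]; ring
    · intro i hi hij
      have hi' : i < j := by
        have := (Finset.mem_filter.1 hi).2; omega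
      rw [opL_C_mul, coeff_C_mul, (degree_lt_iff_coeff_zero _ _).1
        (opL_degree β c5 𝔞 p r q (hX i)).1 j (by omega), mul_zero]
  rw [e1, add_sub_cancel_right]
  exact Finset.sum_congr rfl fun i _ => by rw [opL_C_mul, coeff_C_mul]

theorem eigval_sub_ne_zero {𝔞 : ℂ} (hd : ∀ k : ℕ, 1 + (k : ℂ) * 𝔞 ≠ 0) {n j : ℕ} (hj : j < n) :
    eigval 𝔞 n - eigval 𝔞 j ≠ 0 := by
  obtain ⟨k, rfl⟩ := Nat.exists_eq_add_of_lt hj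
  have h : eigval 𝔞 (j + k + 1) - eigval 𝔞 j =
      ((k + 1 : ℕ) : ℂ) * (1 + ((2 * j + k : ℕ) : ℂ) * 𝔞) := by
    simp only [eigval]; push_cast; ring
  rw [h]
  exact mul_ne_zero (by exact_mod_cast k.succ_ne_zero) (hd _)

/-- Monic eigenvectors depend continuously on the lattice. -/
theorem tendsto_coeff_of_eigen {c5 𝔞 p r q : ℂ} (hd : ∀ k : ℕ, 1 + (k : ℂ) * 𝔞 ≠ 0) {β : ℂ}
    {βs : ℕ → ℂ} (hβ : Tendsto βs atTop (𝓝 β)) {n : ℕ} {f : ℂ[X]} {R : ℕ → ℂ[X]}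
    (hf : f.degree < ((n + 1 : ℕ) : WithBot ℕ)) (hf1 : f.coeff n = 1)
    (hR : ∀ m, (R m).degree < ((n + 1 : ℕ) : WithBot ℕ)) (hR1 : ∀ m, (R m).coeff n = 1)
    (ef : opL β c5 (C 𝔞 * X ^ 2 + C p * X + C r) (X + C q) f = C (eigval 𝔞 n) * f)
    (eR : ∀ m, opL (βs m) c5 (C 𝔞 * X ^ 2 + C p * X + C r) (X + C q) (R m) =
      C (eigval 𝔞 n) * R m) (j : ℕ) :
    Tendsto (fun m => (R m).coeff j) atTop (𝓝 (f.coeff j)) := by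
  -- Induction on n - j: L is triangular with distinct eigenvalues, so each coefficient is a fixed
  -- expression in the higher ones and in entries of L that are continuous in β.
  suffices h : ∀ d j, j ≤ n → n - j = d → Tendsto (fun m => (R m).coeff j) atTop (𝓝 (f.coeff j)) by
    rcases le_or_gt j n with hj | hj
    · exact h _ j hj rfl
    · rw [(degree_lt_iff_coeff_zero _ _).1 hf j hj]
      simp only [fun m => (degree_lt_iff_coeff_zero _ _).1 (hR m) j hj]
      exact tendsto_const_nhds
  intro d
  induction d using Nat.strong_induction_on with
  | _ d ih =>
    intro j hj hjd
    rcases hj.eq_or_lt with rfl | hlt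
    · simp only [hR1, hf1]; exact tendsto_const_nhds
    · have h0 := eigval_sub_ne_zero hd hlt
      have e : ∀ (β : ℂ) (g : ℂ[X]), g.degree < ((n + 1 : ℕ) : WithBot ℕ) →
          opL β c5 (C 𝔞 * X ^ 2 + C p * X + C r) (X + C q) g = C (eigval 𝔞 n) * g →
          g.coeff j = (eigval 𝔞 n - eigval 𝔞 j)⁻¹ *
          ∑ i ∈ (Finset.range (n + 1)).filter (j < ·), g.coeff i *
          (opL β c5 (C 𝔞 * X ^ 2 + C p * X + C r) (X + C q) (X ^ i)).coeff j := by
        intro β g hg h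
        rw [← eigen_coeff β c5 𝔞 p r q hg h hlt, inv_mul_cancel_left₀ h0]
      rw [e β f hf ef]
      simp only [fun m => e (βs m) (R m) (hR m) (eR m)]
      refine tendsto_const_nhds.mul (tendsto_finsetSum _ fun i hi => ?_)
      rw [Finset.mem_filter, Finset.mem_range] at hi
      exact (ih (n - i) (by omega) i (by omega) rfl).mul
        ((coeffContinuousAt_opL_X_pow c5 β _ _ i j).tendsto.comp hβ)

theorem continuousAt_poch {g : ℂ → ℂ} {x : ℂ} (hg : ContinuousAt g x) (n : ℕ) :
    ContinuousAt (fun t => poch (g t) n) x := by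
  simp only [poch]
  exact tendsto_finsetProd _ fun i _ => hg.add continuousAt_const

theorem coeffContinuousAt_wBasis (κ μ a : ℂ) (k : ℕ) :
    CoeffContinuousAt (fun ε => wBasis κ μ (a + ε) k) 0 := by
  refine CoeffContinuousAt.prod_range k fun j => ?_
  exact (CoeffContinuousAt.const _ _).add (CoeffContinuousAt.scalar (by fun_prop))

theorem coeffContinuousAt_monicSum {κ μ a : ℂ} (hκ : κ ≠ 0) {w : ℂ → ℕ → ℂ} {n : ℕ}
    (hw : ∀ k, ContinuousAt (fun ε => w ε k) 0) (h0 : w 0 n ≠ 0) :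
    CoeffContinuousAt (fun ε => monicSum κ μ (a + ε) (w ε) n) 0 := by
  refine (CoeffContinuousAt.scalar (ContinuousAt.inv₀ ((hw n).mul continuousAt_const)
    (mul_ne_zero h0 (pow_ne_zero _ hκ)))).mul (CoeffContinuousAt.sum _ fun k _ =>
    (CoeffContinuousAt.scalar (hw k)).mul (coeffContinuousAt_wBasis κ μ a k))

theorem continuousAt_wilsonCoeff (a b c d : ℂ) (n k : ℕ) :
    ContinuousAt (fun ε => wilsonCoeff (a + ε) (b + ε) (c + ε) (d + ε) n k) 0 := by
  have h1 := continuousAt_poch (g := fun ε => n + (a + ε) + (b + ε) + (c + ε) + (d + ε) - 1)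
    (x := 0) (by fun_prop) k
  have h2 := continuousAt_poch (g := fun ε => (a + ε) + (b + ε) + k) (x := 0) (by fun_prop) (n - k)
  have h3 := continuousAt_poch (g := fun ε => (a + ε) + (c + ε) + k) (x := 0) (by fun_prop) (n - k)
  have h4 := continuousAt_poch (g := fun ε => (a + ε) + (d + ε) + k) (x := 0) (by fun_prop) (n - k)
  exact ((continuousAt_const.mul h1).div_const _).mul ((h2.mul h3).mul h4)

theorem continuousAt_hahnCoeff (a b c : ℂ) (n k : ℕ) :
    ContinuousAt (fun ε => hahnCoeff (a + ε) (b + ε) (c + ε) n k) 0 := by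
  have h2 := continuousAt_poch (g := fun ε => (a + ε) + (b + ε) + k) (x := 0) (by fun_prop) (n - k)
  have h3 := continuousAt_poch (g := fun ε => (a + ε) + (c + ε) + k) (x := 0) (by fun_prop) (n - k)
  exact continuousAt_const.mul (h2.mul h3)

/-! ### Approximation by admissible parameters and the limit β → 0 -/

theorem exists_near_of_countable {F : ℕ → ℂ → ℂ[X]} (hF : ∀ n, CoeffContinuousAt (F n) 0)
    {S : Set ℂ} (hS : S.Countable) (N : ℕ) {η : ℝ} (hη : 0 < η) :
    ∃ ε ∉ S, ∀ n < N, ∀ k < N, dist ((F n ε).coeff k) ((F n 0).coeff k) < η := by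
  have h : ∀ᶠ ε in 𝓝 (0 : ℂ), ∀ n ∈ Finset.range N, ∀ k ∈ Finset.range N,
      dist ((F n ε).coeff k) ((F n 0).coeff k) < η := by
    rw [Filter.eventually_all_finset]
    intro n _
    rw [Filter.eventually_all_finset]
    intro k _
    exact (hF n k).tendsto.eventually (Metric.ball_mem_nhds _ hη)
  obtain ⟨ε, h1, h2⟩ := (hS.dense_compl ℂ).inter_nhds_nonempty h
  exact ⟨ε, h1, fun n hn k hk => h2 n (Finset.mem_range.2 hn) k (Finset.mem_range.2 hk)⟩

/-- Adding ε to all four parameters moves each pair sum by 2ε and the total by 4ε, so only countably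
many ε are bad. The condition on the total at ε = 0 keeps the leading coefficient nonzero, hence the
monic normalisation continuous. -/
theorem exists_isWilson_near {κ μ a b c d : ℂ} (hκ : κ ≠ 0)
    (h : ∀ k : ℕ, a + b + c + d ≠ -(k : ℂ)) (N : ℕ) {η : ℝ} (hη : 0 < η) :
    ∃ Q : ℕ → ℂ[X], (∀ n, (Q n).Monic) ∧ IsWilson κ μ Q ∧ ∀ n < N, ∀ k < N,
      dist ((Q n).coeff k) ((monicSum κ μ a (wilsonCoeff a b c d n) n).coeff k) < η := by
  let S : Set ℂ := ⋃ k : ℕ, {(-k - (a + b)) / 2, (-k - (a + c)) / 2, (-k - (a + d)) / 2,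
    (-k - (b + c)) / 2, (-k - (b + d)) / 2, (-k - (c + d)) / 2, (-k - (a + b + c + d)) / 4}
  have hS : S.Countable := Set.countable_iUnion fun k => (Set.toFinite _).countable
  obtain ⟨ε, hε, hn⟩ := exists_near_of_countable (F := fun n ε =>
    monicSum κ μ (a + ε) (wilsonCoeff (a + ε) (b + ε) (c + ε) (d + ε) n) n)
    (fun n => coeffContinuousAt_monicSum hκ (fun k => continuousAt_wilsonCoeff a b c d n k)
      (by simpa using wilsonCoeff_self_ne_zero h n)) hS N hη
  have hp : WilsonParams (a + ε) (b + ε) (c + ε) (d + ε) := by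
    intro k
    simp only [S, Set.mem_iUnion, Set.mem_insert_iff, Set.mem_singleton_iff, not_exists,
      not_or] at hε
    obtain ⟨h1, h2, h3, h4, h5, h6, h7⟩ := hε k
    refine ⟨fun h => h1 ?_, fun h => h2 ?_, fun h => h3 ?_, fun h => h4 ?_, fun h => h5 ?_,
      fun h => h6 ?_, fun h => h7 ?_⟩
    · linear_combination h / 2
    · linear_combination h / 2
    · linear_combination h / 2
    · linear_combination h / 2
    · linear_combination h / 2
    · linear_combination h / 2
    · linear_combination h / 4
  refine ⟨_, fun n => ?_, isWilson_monicSum hκ hp, by simpa using hn⟩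
  have := monicSum_degree (μ := μ) (a := a + ε) hκ
    (wilsonCoeff_self_ne_zero (fun m => (hp m).2.2.2.2.2.2) n)
  exact monic_of_degree_lt this.1 this.2

theorem exists_isContDualHahn_near {κ μ : ℂ} (a b c : ℂ) (hκ : κ ≠ 0)
    (N : ℕ) {η : ℝ} (hη : 0 < η) :
    ∃ Q : ℕ → ℂ[X], (∀ n, (Q n).Monic) ∧ IsContDualHahn κ μ Q ∧ ∀ n < N, ∀ k < N,
      dist ((Q n).coeff k) ((monicSum κ μ a (hahnCoeff a b c n) n).coeff k) < η := by
  let S : Set ℂ := ⋃ k : ℕ, {(-k - (a + b)) / 2, (-k - (a + c)) / 2, (-k - (b + c)) / 2}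
  have hS : S.Countable := Set.countable_iUnion fun k => (Set.toFinite _).countable
  obtain ⟨ε, hε, hn⟩ := exists_near_of_countable (F := fun n ε =>
    monicSum κ μ (a + ε) (hahnCoeff (a + ε) (b + ε) (c + ε) n) n)
    (fun n => coeffContinuousAt_monicSum hκ (fun k => continuousAt_hahnCoeff a b c n k)
      (by simpa using hahnCoeff_self_ne_zero a b c n)) hS N hη
  have hp : ContDualHahnParams (a + ε) (b + ε) (c + ε) := by
    intro k
    simp only [S, Set.mem_iUnion, Set.mem_insert_iff, Set.mem_singleton_iff, not_exists,
      not_or] at hε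
    obtain ⟨h1, h2, h3⟩ := hε k
    refine ⟨fun h => h1 ?_, fun h => h2 ?_, fun h => h3 ?_⟩
    · linear_combination h / 2
    · linear_combination h / 2
    · linear_combination h / 2
  refine ⟨_, fun n => ?_, isContDualHahn_monicSum hκ hp, by simpa using hn⟩
  have := monicSum_degree (μ := μ) (a := a + ε) hκ (hahnCoeff_self_ne_zero (a + ε) (b + ε) (c + ε) n)
  exact monic_of_degree_lt this.1 this.2

/-- Near the eigenvectors on a quadratic lattice there are Wilson or continuous dual Hahn
polynomials. -/
theorem exists_near_eigen {β : ℂ} (hβ : β ≠ 0) (c5 𝔞 p r q : ℂ)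
    (hd : ∀ k : ℕ, 1 + (k : ℂ) * 𝔞 ≠ 0) (N : ℕ) {η : ℝ} (hη : 0 < η) :
    ∃ Q E : ℕ → ℂ[X], ((∀ n, (Q n).Monic) ∧
      ∃ κ μ : ℂ, κ ≠ 0 ∧ (IsWilson κ μ Q ∨ IsContDualHahn κ μ Q)) ∧
      (∀ n, (E n).degree < ((n + 1 : ℕ) : WithBot ℕ) ∧ (E n).coeff n = 1 ∧
        opL β c5 (C 𝔞 * X ^ 2 + C p * X + C r) (X + C q) (E n) = C (eigval 𝔞 n) * E n) ∧
      ∀ n < N, ∀ k < N, dist ((Q n).coeff k) ((E n).coeff k) < η := by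
  have hl : (β, c5) ≠ (0, 0) := fun h => hβ (congrArg Prod.fst h)
  obtain ⟨κ, hκ⟩ : ∃ κ : ℂ, 4 * β * κ = -1 := ⟨-1 / (4 * β), by field_simp⟩
  have hκ0 : κ ≠ 0 := by rintro rfl; simp at hκ
  obtain ⟨μ, hμ⟩ : ∃ μ : ℂ, μ = -(κ ^ 2 * (c5 ^ 2 / 4)) := ⟨_, rfl⟩
  -- E consists of the exact eigenvectors and Q of nearby admissible families. On this lattice no
  -- orthogonality is assumed, so the common-zero argument cannot exclude forbidden pair sums for E.
  by_cases h𝔞 : 𝔞 = 0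
  · subst h𝔞
    obtain ⟨a, b, c, h⟩ := exists_hahnRoots p r q κ μ
    obtain ⟨Q, h1, h2, h3⟩ := exists_isContDualHahn_near (μ := μ) a b c hκ0 N hη
    refine ⟨Q, _, ⟨h1, κ, μ, hκ0, Or.inr h2⟩, fun n => ?_, h3⟩
    have h4 := monicSum_degree (μ := μ) (a := a) hκ0 (hahnCoeff_self_ne_zero a b c n)
    exact ⟨h4.1, h4.2, opL_hahn hl hκ hμ h n⟩
  · obtain ⟨a, b, c, d, h⟩ := exists_wilsonRoots h𝔞 p r q κ μ
    obtain ⟨Q, h1, h2, h3⟩ := exists_isWilson_near (μ := μ) hκ0 (h.sum_ne hd) N hη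
    refine ⟨Q, _, ⟨h1, κ, μ, hκ0, Or.inl h2⟩, fun n => ?_, h3⟩
    have h4 := monicSum_degree (μ := μ) (a := a) hκ0 (wilsonCoeff_self_ne_zero (h.sum_ne hd) n)
    exact ⟨h4.1, h4.2, opL_wilson hl hκ hμ h n⟩

/-- Replacing β = 0 by 1/(m+1) with φ, ψ and 𝔠₅ fixed leaves the eigenvalues unchanged, so the
condition `hd` serves every approximating lattice. -/
theorem isLimitingCase_of_eigen {c5 𝔞 p r q : ℂ} {P : ℕ → ℂ[X]}
    (hd : ∀ k : ℕ, 1 + (k : ℂ) * 𝔞 ≠ 0)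
    (hP : ∀ n, (P n).degree < ((n + 1 : ℕ) : WithBot ℕ) ∧ (P n).coeff n = 1 ∧
      opL 0 c5 (C 𝔞 * X ^ 2 + C p * X + C r) (X + C q) (P n) = C (eigval 𝔞 n) * P n) :
    IsLimitingCase P := by
  have hβ : ∀ m : ℕ, (1 / ((m : ℂ) + 1)) ≠ 0 := fun m =>
    one_div_ne_zero (by exact_mod_cast m.succ_ne_zero)
  have hη : ∀ m : ℕ, (0 : ℝ) < 1 / ((m : ℝ) + 1) := fun m => by positivity
  -- The m-th family is within 1/(m+1) for indices below m, so any fixed n and k are eventually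
  -- covered.
  choose Q E hQ hE hn using fun m : ℕ => exists_near_eigen (hβ m) c5 𝔞 p r q hd m (hη m)
  refine ⟨Q, hQ, fun n k => ?_⟩
  have h1 := tendsto_coeff_of_eigen hd (tendsto_one_div_add_atTop_nhds_zero_nat (𝕜 := ℂ))
    (hP n).1 (hP n).2.1 (fun m => (hE m n).1) (fun m => (hE m n).2.1) (hP n).2.2
    (fun m => (hE m n).2.2) k
  refine (tendsto_iff_of_dist ?_).2 h1
  refine squeeze_zero' (Eventually.of_forall fun _ => dist_nonneg) ?_
    (tendsto_one_div_add_atTop_nhds_zero_nat (𝕜 := ℝ))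
  filter_upwards [eventually_gt_atTop (max n k)] with m hm
  exact (hn m n (by omega) k (by omega)).le

end QuadLattice

/-! ### Assembly of the main theorem -/

theorem mainTheorem3
    (β c5 : ℂ) (hlat : (β, c5) ≠ (0, 0))
    (u : ℂ[X] →ₗ[ℂ] ℂ) (P : ℕ → ℂ[X]) (hP : IsMonicOPS u P)
    (B Cc : ℕ → ℂ) (hB : B = recB u P) (hC : Cc = recC u P)
    (a b c : ℂ) (an bn cn : ℕ → ℂ)
    (hrel : ∀ n, (C a * X ^ 2 + C b * X + C c) * Dx β c5 (P n) =
      C (an n) * Sx β c5 (P (n + 1)) + C (bn n) * Sx β c5 (P n) + C (cn n) * Sx β c5 (prev P n))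
    (hcn : ∀ n, cn n ≠ 0)
    (r₂ r₃ b' : ℂ) (hr₂ : r₂ = cn 2 + 2 * a * Cc 2) (hr₃ : r₃ = cn 3 + 2 * a * Cc 3)
    (hb' : b' = b + 2 * a * β)
    (hcond₁ : a ≠ 0 →
      6 * a * Cc 2 * Cc 3 + 4 * r₃ * (Cc 1 - c5 ^ 2 / 4) +
        r₃ * ((B 1 - B 0) ^ 2 - 8 * β * (B 0 + B 1 - 2 * β) - 2 * Cc 2) = 0)
    (hcond₂ : a * Cc 2 * Cc 3 * (bn 2 + 2 * a * B 2 + b') -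
      r₃ * (a * (B 2 + B 1) * Cc 2 + b' * Cc 2 - r₂ / 2 * (B 1 - B 0)) = 0)
    (𝔞 𝔟 : ℂ) (h𝔞 : 𝔞 = -(a * Cc 3) / r₃) (h𝔟 : 𝔟 = (B 1 - B 0 + 4 * β) / 2)
    (φ ψ : ℂ[X])
    (hφ : φ = (X - C (B 0)) * (C 𝔞 * X - C 𝔟 - C (𝔞 * B 1)) - C ((𝔞 + 1) * Cc 1))
    (hψ : ψ = X - C (B 0)) :
    (β ≠ 0 →
      IsWilson (-1 / (4 * β)) (-(c5 ^ 2) / (64 * β ^ 2)) P ∨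
        IsContDualHahn (-1 / (4 * β)) (-(c5 ^ 2) / (64 * β ^ 2)) P) ∧
    (β = 0 → IsLimitingCase P) ∧
    r₃ ≠ 0 ∧
    ∀ n : ℕ, φ * Dx β c5 (Dx β c5 (P n)) + ψ * Sx β c5 (Dx β c5 (P n)) =
      C ((n : ℂ) * (1 + ((n : ℂ) - 1) * 𝔞)) * P n := by
  have hC0 : P 0 = 1 := hP.zero_eq
  have p1 : P 1 = X - C (B 0) := by rw [hP.recurrence 0, hB, hC0]; simp [prev]
  have p2 : P 2 = (X - C (B 1)) * P 1 - C (Cc 1) := by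
    rw [hP.recurrence 1, hB, hC]; simp [prev, hC0]
  obtain ⟨hr, hfun⟩ := functional_equation hlat hP B Cc hB hC a b c an bn cn hrel hcn r₂ r₃ b'
    hr₂ hr₃ hb' hcond₁ hcond₂ 𝔞 𝔟 h𝔞 h𝔟
  -- φ is needed in two forms: in powers of z for the spectral lemmas, and in `P 2`, `P 1` and a
  -- constant for the Pearson equation.
  have hφ' : φ = C 𝔞 * X ^ 2 + C (-(𝔟 + 𝔞 * B 1 + 𝔞 * B 0)) * X +
      C (B 0 * (𝔟 + 𝔞 * B 1) - (𝔞 + 1) * Cc 1) := by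
    rw [hφ]; simp only [C_add, C_sub, C_mul, C_neg, C_1]; ring
  have hφP : φ = C 𝔞 * P 2 - C 𝔟 * P 1 - C (Cc 1) := by
    rw [hφ, p2, p1]; simp only [C_add, C_mul, C_1]; ring
  have hψ' : ψ = X + C (-B 0) := by rw [hψ, C_neg, sub_eq_add_neg]
  rw [← hφP, p1, ← hψ, hφ', hψ'] at hfun
  have hd := eigen_admissible hlat hP hfun
  have he := opL_eigen hlat hP hfun
  refine ⟨fun hβ => ?_, fun hβ => ?_, hr, fun n => ?_⟩
  · have hκ : 4 * β * (-1 / (4 * β)) = -1 := by field_simp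
    have hμ : -(c5 ^ 2) / (64 * β ^ 2) = -((-1 / (4 * β)) ^ 2 * (c5 ^ 2 / 4)) := by
      field_simp; norm_num
    by_cases h0 : 𝔞 = 0
    · exact Or.inr (isContDualHahn_of_eigen hβ hP he hκ hμ h0)
    · exact Or.inl (isWilson_of_eigen hβ hP hd he hκ hμ h0)
  · subst hβ
    exact isLimitingCase_of_eigen hd fun n => ⟨hP.degree_lt n, hP.coeff_self n, he n⟩
  · rw [hφ', hψ']
    exact he n
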